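/- Theorem. Operator spaces are complex and complete: a complex Banach space $V$ together with norms on the spaces $M_n(V)$ of $n\times n$ matrices over $V$ ($n\ge 0$), the norm on $M_1(V)=V$ being the given one, such that $\|v\oplus w\|=\max\{\|v\|,\|w\|\}$ and $\|\alpha v\beta\|\le\|\alpha\|\,\|v\|\,\|\beta\|$ for all $v\in M_m(V)$, $w\in M_n(V)$ (in the first condition) and all rectangular scalar matrices $\alpha\in M_{n,m}$, $\beta\in M_{m,n}$ (in the second), where scalar matrices carry the operator norm. For a linear map $\varphi:W\to V$ let $\varphi_n:M_n(W)\to M_n(V)$ be its entrywise extension; put $\|\varphi\|_{cb}=\sup\{\|\varphi_n(w)\| : n\in\mathbb N,\ w\in M_n(W),\ \|w\|\le 1\}$, and let $CB(W,V)$ be the set of all $\varphi$ with $\|\varphi\|_{cb}<\infty$. Let $\mathcal K$ be the compact operators on $\ell^2$ and let $\mathcal K(V)\cong\mathcal K\check\otimes_{op}V$ (completed minimal tensor product) be realized as the closure of the set of infinite matrices over $V$ with finitely many nonzero entries, for the norm $\|x\|=\sup_n\|[x_{ij}]_{i,j\le n}\|$; here $(\mathrm{id}\otimes\varphi)(x)=[\varphi(x_{ij})]$.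 The operator space $V$ has the \emph{operator approximation property} if the identity of $V$ lies in the closure of the finite rank maps in $CB(V,V)$ for the stable point-norm topology, that is, if for all $x_1,\dots,x_r\in\mathcal K(V)$ and $\varepsilon>0$ there is a finite rank $\psi\in CB(V,V)$ with $\|(\mathrm{id}\otimes\psi)(x_s)-x_s\|<\varepsilon$ for $s=1,\dots,r$. For $x\in\mathcal K(V)$, the \emph{absolutely matrix convex hull} of $x$ is the family of sets $$(\mathrm{co}\,x)_k=\{(\sigma\otimes\mathrm{id})(x) : \sigma\in M_k(M_\infty),\ \|\sigma\|\le 1\}\subseteq M_k(V)\qquad(k\in\mathbb N),$$ where $M_\infty$ is the space of infinite scalar matrices with finitely many nonzero entries, each $\sigma_{ij}\in M_\infty$ is regarded as the functional $a\mapsto\sum_{p,q}(\sigma_{ij})_{pq}a_{pq}$, so that $(\sigma\otimes\mathrm{id})(x)=[\sum_{p,q}(\sigma_{ij})_{pq}x_{pq}]_{i,j}$, and $\|\sigma\|$ is the norm of $\sigma$ in $M_k(\mathcal T)=CB(\mathcal K,M_k)$, $\mathcal T=\mathcal K^*$ being the trace class operators. A linear map $\varphi:W\to V$ is \emph{operator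 compact} if there is $x\in\mathcal K(V)$ such that, for every $n$, $\varphi_n(w)$ lies in the norm closure of $(\mathrm{co}\,x)_n$ in $M_n(V)$ for all $w\in M_n(W)$ with $\|w\|\le 1$. Then an operator space $V$ has the operator approximation property if and only if, for every operator space $W$, every operator compact map $\varphi\in CB(W,V)$ and every $\varepsilon>0$, there is a finite rank map $\psi\in CB(W,V)$ with $\|\varphi-\psi\|_{cb}<\varepsilon$. -/

import Mathlib

open scoped ENNReal

universe u

section ScalarNorm

open scoped Matrix.Norms.L2Operator

/-- The operator norm of a (rectangular) complex matrix, acting between Euclidean spaces. -/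
noncomputable def scalarNorm {m n : Type*} [Fintype m] [Fintype n] [DecidableEq n]
    (α : Matrix m n ℂ) : ℝ := ‖α‖

end ScalarNorm

/-- The two-sided product `α v β` of a matrix `v` over a complex vector space with scalar
matrices. -/
def Matrix.biact {V : Type*} [AddCommGroup V] [Module ℂ V] {m n : ℕ}
    (α : Matrix (Fin n) (Fin m) ℂ) (v : Matrix (Fin m) (Fin m) V)
    (β : Matrix (Fin m) (Fin n) ℂ) : Matrix (Fin n) (Fin n) V :=
  fun i j => ∑ k, ∑ l, (α i k * β l j) • v k l

/-- The block diagonal matrix `v ⊕ w`. -/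
def Matrix.dirSum {V : Type*} [Zero V] {m n : ℕ}
    (v : Matrix (Fin m) (Fin m) V) (w : Matrix (Fin n) (Fin n) V) :
    Matrix (Fin (m + n)) (Fin (m + n)) V :=
  Matrix.reindex finSumFinEquiv finSumFinEquiv (Matrix.fromBlocks v 0 0 w)

/-- An operator space structure on a normed space: norms on the matrix spaces `M_n(V)`, which
for `n = 1` are the given norm, and which satisfy the two axioms of Ruan. Completeness is asked
for separately, by `CompleteSpace V`. -/
class OperatorSpace (V : Type*) [NormedAddCommGroup V] [NormedSpace ℂ V] where
  mnorm : (n : ℕ) → Matrix (Fin n) (Fin n) V → ℝ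
  mnorm_add_le : ∀ (n : ℕ) (v w : Matrix (Fin n) (Fin n) V),
    mnorm n (v + w) ≤ mnorm n v + mnorm n w
  mnorm_smul : ∀ (n : ℕ) (c : ℂ) (v : Matrix (Fin n) (Fin n) V),
    mnorm n (c • v) = ‖c‖ * mnorm n v
  eq_zero_of_mnorm_eq_zero : ∀ (n : ℕ) (v : Matrix (Fin n) (Fin n) V), mnorm n v = 0 → v = 0
  mnorm_one : ∀ v : V, mnorm 1 (Matrix.of fun _ _ => v) = ‖v‖
  mnorm_dirSum : ∀ (m n : ℕ) (v : Matrix (Fin m) (Fin m) V) (w : Matrix (Fin n) (Fin n) V),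
    mnorm (m + n) (Matrix.dirSum v w) = max (mnorm m v) (mnorm n w)
  mnorm_biact_le : ∀ (m n : ℕ) (α : Matrix (Fin n) (Fin m) ℂ) (v : Matrix (Fin m) (Fin m) V)
    (β : Matrix (Fin m) (Fin n) ℂ),
    mnorm n (Matrix.biact α v β) ≤ scalarNorm α * mnorm m v * scalarNorm β

namespace OperatorSpace

variable {V : Type*} [NormedAddCommGroup V] [NormedSpace ℂ V] [OperatorSpace V]
variable {W : Type*} [NormedAddCommGroup W] [NormedSpace ℂ W] [OperatorSpace W]

/-- The completely bounded norm `sup {‖φ_n(w)‖ : n ∈ ℕ, w ∈ M_n(W), ‖w‖ ≤ 1}`,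
possibly infinite. -/
noncomputable def cbNorm (φ : W →ₗ[ℂ] V) : ℝ≥0∞ :=
  ⨆ (n : ℕ) (w : Matrix (Fin n) (Fin n) W) (_ : mnorm n w ≤ 1),
    ENNReal.ofReal (mnorm n (w.map φ))

/-- `φ ∈ CB(W, V)`. -/
def IsCompletelyBounded (φ : W →ₗ[ℂ] V) : Prop := cbNorm φ < ⊤

/-- Finite rank. -/
def IsFiniteRank (φ : W →ₗ[ℂ] V) : Prop := FiniteDimensional ℂ (LinearMap.range φ)

/-- The upper left `n × n` corner of an infinite matrix. -/
def corner {E : Type*} (n : ℕ) (x : Matrix ℕ ℕ E) : Matrix (Fin n) (Fin n) E :=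
  x.submatrix Fin.val Fin.val

/-- The (possibly infinite) norm of an infinite matrix over `V`: the supremum of the norms of
its corners. -/
noncomputable def infNorm (x : Matrix ℕ ℕ V) : ℝ≥0∞ :=
  ⨆ n : ℕ, ENNReal.ofReal (mnorm n (corner n x))

/-- The space `𝒦(V)`, that is, the completed minimal tensor product of the compact operators on
`ℓ²` with `V`, realized as infinite matrices over `V`: the closure of the set of matrices with
finitely many nonzero entries, for the norm `infNorm`. -/
def stabilization (V : Type*) [NormedAddCommGroup V] [NormedSpace ℂ V] [OperatorSpace V] :
    Set (Matrix ℕ ℕ V) :=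
  {x | ∀ ε : ℝ≥0∞, 0 < ε → ∃ y : Matrix ℕ ℕ V,
    {p : ℕ × ℕ | y p.1 p.2 ≠ 0}.Finite ∧ infNorm (x - y) < ε}

/-- The operator approximation property: the identity of `V` lies in the closure of the
completely bounded finite rank maps for the stable point-norm topology. A basic neighbourhood of
a map `φ` in this topology is given by finitely many `x ∈ 𝒦(V)` and an `ε > 0`, and
`(id ⊗ φ)(x)` is the entrywise image of `x` under `φ`. -/
def HasOAP (V : Type*) [NormedAddCommGroup V] [NormedSpace ℂ V] [OperatorSpace V] : Prop :=
  ∀ F : Finset (Matrix ℕ ℕ V), (∀ x ∈ F, x ∈ stabilization V) → ∀ ε : ℝ≥0∞, 0 < ε →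
    ∃ ψ : V →ₗ[ℂ] V, IsCompletelyBounded ψ ∧ IsFiniteRank ψ ∧
      ∀ x ∈ F, infNorm (x.map ψ - x) < ε

/-- The action `(σ ⊗ id)(x)`, where the entries `σ i j` of `σ ∈ M_k(M_N)` are viewed as linear
functionals `a ↦ ∑ p, ∑ q, σ i j p q * a p q` on `N × N` matrices. -/
def tcAct {E : Type*} [AddCommGroup E] [Module ℂ E] {k N : ℕ}
    (σ : Matrix (Fin k) (Fin k) (Matrix (Fin N) (Fin N) ℂ)) (x : Matrix (Fin N) (Fin N) E) :
    Matrix (Fin k) (Fin k) E :=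
  fun i j => ∑ p, ∑ q, σ i j p q • x p q

/-- The norm of `σ ∈ M_k(M_N) ⊆ M_k(𝒯)`, where `𝒯` is the operator space of trace class operators
on `ℓ²`, the dual of the compact operators `𝒦`: it is the completely bounded norm of
`a ↦ (σ ⊗ id)(a)` as a map into `M_k`. Since `σ` sees only the `N × N` corner, the map may be
taken on `M_N` in place of `𝒦`. The spaces `M_m(M_N)` and `M_m(M_k)` are normed as spaces of
`mN × mN` and `mk × mk` scalar matrices. -/
noncomputable def tcNorm {k N : ℕ}
    (σ : Matrix (Fin k) (Fin k) (Matrix (Fin N) (Fin N) ℂ)) : ℝ≥0∞ :=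
  ⨆ (m : ℕ) (a : Matrix (Fin m) (Fin m) (Matrix (Fin N) (Fin N) ℂ))
    (_ : scalarNorm (Matrix.comp _ _ _ _ _ a) ≤ 1),
    ENNReal.ofReal (scalarNorm (Matrix.comp _ _ _ _ _ (a.map (tcAct σ))))

/-- The `k`-th level of the absolutely matrix convex hull of an infinite matrix `x`: all
`(σ ⊗ id)(x)` with `σ` a `k × k` matrix of finitely supported infinite scalar matrices (so that
`σ ∈ M_k(M_N)` for some `N`) and `‖σ‖ ≤ 1` in `M_k(𝒯)`. -/
def hull (x : Matrix ℕ ℕ V) (k : ℕ) : Set (Matrix (Fin k) (Fin k) V) :=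
  {v | ∃ (N : ℕ) (σ : Matrix (Fin k) (Fin k) (Matrix (Fin N) (Fin N) ℂ)),
    tcNorm σ ≤ 1 ∧ v = tcAct σ (corner N x)}

/-- The `k`-th level of the closed absolutely matrix convex hull of `x`: the norm closure in
`M_k(V)` of `hull x k`. -/
def closedHull (x : Matrix ℕ ℕ V) (k : ℕ) : Set (Matrix (Fin k) (Fin k) V) :=
  {v | ∀ ε : ℝ, 0 < ε → ∃ w ∈ hull x k, mnorm k (v - w) < ε}

/-- Operator compact maps: the image of the matrix unit ball lies in the closed absolutely matrix
convex hull of some `x ∈ 𝒦(V)`. -/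
def IsOperatorCompact (φ : W →ₗ[ℂ] V) : Prop :=
  ∃ x ∈ stabilization V, ∀ (n : ℕ) (w : Matrix (Fin n) (Fin n) W),
    mnorm n w ≤ 1 → w.map φ ∈ closedHull x n

end OperatorSpace

/-! Forward implication. Let the hull of $x$ control $\varphi$ and let $\psi$ be a finite rank map
with $\|(\mathrm{id}\otimes\psi)(x)-x\|$ small. A matrix $\varphi_n(w)$ with $\|w\|\le 1$ is nearly
$(\sigma\otimes\mathrm{id})(x)$, and $\psi-\mathrm{id}$ commutes with $\sigma$, so $\psi\varphi$ is
close to $\varphi$ in cb norm as soon as $\sigma$ acts contractively on matrices over $V$. That last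
point is `mnorm_tcAct_le`. The norm of $\sigma$ only speaks of scalar matrices, so the proof passes
through enough complete contractions $V\to M_k$ (`exists_norming_contraction`). This is the core of
Ruan's representation theorem, and it rests on a Hahn-Banach argument (`exists_positive_majorants`).

Converse. Finitely many elements of $\mathcal K(V)$ are compressions of one $x$
(`exists_common_dilation`), and $x=sys$ with $y\in\mathcal K(V)$ and $s$ a compact diagonal operator
(`exists_diagonal_factorization`). The closed hull of $y$ is the matrix unit ball of an operator
space $W$ (`HullSpace`), which is complete and whose inclusion into $V$ is operator compact. Since
$s$ is compact, $x$ is the image of some $w\in\mathcal K(W)$ (`exists_hullSpace_lift`). The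
hypothesis approximates the inclusion by a finite rank $\psi=\sum f_i\otimes b_i$ with $f_i\in W^*$.

It remains to replace the $f_i$ by functionals on $V$, uniformly on $w$
(`exists_functional_approx`). If $(\mathrm{id}\otimes f)(w)$ were at positive distance from all
$(\mathrm{id}\otimes g\varphi)(w)$ with $g\in V^*$, where $\varphi$ is the inclusion, a functional
$\tau$ would separate it from them. The slice $u=(\tau\otimes\mathrm{id})(w)\in W$ would satisfy
$g(\varphi u)=0$ for all $g$ and $f(u)\ne 0$, against the injectivity of $\varphi$. -/

/-! ### Operator norms of scalar matrices. -/

section ScalarNormLemmas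

open scoped Matrix.Norms.L2Operator

variable {m n l : Type*} [Fintype m] [Fintype n] [Fintype l] [DecidableEq m] [DecidableEq n]

omit [DecidableEq m] in
theorem scalarNorm_nonneg (A : Matrix m n ℂ) : 0 ≤ scalarNorm A := norm_nonneg _

omit [DecidableEq m] in
theorem scalarNorm_add_le (A B : Matrix m n ℂ) :
    scalarNorm (A + B) ≤ scalarNorm A + scalarNorm B := norm_add_le _ _

omit [DecidableEq m] in
theorem scalarNorm_smul (c : ℂ) (A : Matrix m n ℂ) :
    scalarNorm (c • A) = ‖c‖ * scalarNorm A := norm_smul _ _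

omit [DecidableEq m] in
theorem scalarNorm_zero : scalarNorm (0 : Matrix m n ℂ) = 0 := norm_zero

theorem scalarNorm_conjTranspose (A : Matrix m n ℂ) : scalarNorm A.conjTranspose = scalarNorm A :=
  Matrix.l2_opNorm_conjTranspose A

omit [DecidableEq m] in
theorem scalarNorm_conjTranspose_mul_self (A : Matrix m n ℂ) :
    scalarNorm (A.conjTranspose * A) = scalarNorm A ^ 2 := by
  rw [sq]; exact Matrix.l2_opNorm_conjTranspose_mul_self A

theorem scalarNorm_mul_conjTranspose_self (A : Matrix m n ℂ) :
    scalarNorm (A * A.conjTranspose) = scalarNorm A ^ 2 := by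
  have := scalarNorm_conjTranspose_mul_self A.conjTranspose
  rwa [Matrix.conjTranspose_conjTranspose, scalarNorm_conjTranspose] at this

theorem scalarNorm_mul_le (A : Matrix l m ℂ) (B : Matrix m n ℂ) :
    scalarNorm (A * B) ≤ scalarNorm A * scalarNorm B := Matrix.l2_opNorm_mul A B

theorem scalarNorm_diagonal_le {d : n → ℂ} {r : ℝ} (hr : 0 ≤ r) (h : ∀ i, ‖d i‖ ≤ r) :
    scalarNorm (Matrix.diagonal d) ≤ r := by
  unfold scalarNorm
  rw [Matrix.l2_opNorm_diagonal]
  exact (pi_norm_le_iff_of_nonneg hr).2 h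

omit [DecidableEq m] in
theorem sum_norm_sq_mulVec_le (A : Matrix m n ℂ) (x : n → ℂ) :
    ∑ i, ‖A.mulVec x i‖ ^ 2 ≤ scalarNorm A ^ 2 * ∑ j, ‖x j‖ ^ 2 := by
  have h := Matrix.l2_opNorm_mulVec A (WithLp.toLp 2 x)
  have h2 := pow_le_pow_left₀ (norm_nonneg _) h 2
  rw [mul_pow, EuclideanSpace.norm_sq_eq, EuclideanSpace.norm_sq_eq] at h2
  exact h2

omit [DecidableEq m] in
theorem scalarNorm_le_of_mulVec {A : Matrix m n ℂ} {r : ℝ} (hr : 0 ≤ r)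
    (h : ∀ x : n → ℂ, ∑ i, ‖A.mulVec x i‖ ^ 2 ≤ r ^ 2 * ∑ j, ‖x j‖ ^ 2) : scalarNorm A ≤ r := by
  unfold scalarNorm
  rw [Matrix.l2_opNorm_def]
  refine ContinuousLinearMap.opNorm_le_bound _ hr fun x => ?_
  refine le_of_sq_le_sq ?_ (by positivity)
  rw [mul_pow, EuclideanSpace.norm_sq_eq, EuclideanSpace.norm_sq_eq]
  exact h x.ofLp

omit [DecidableEq m] in
-- Cauchy-Schwarz followed by a weighted arithmetic-geometric mean inequality. Together with its
-- converse `scalarNorm_le_of_form` it expresses the operator norm by an inequality whose two sides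
-- add up over orthogonal blocks, so that direct sums are handled by addition.
theorem two_mul_re_form_le (A : Matrix m n ℂ) (x : n → ℂ) (y : m → ℂ) :
    2 * (∑ i, ∑ j, star (y i) * A i j * x j).re ≤
      scalarNorm A * (∑ j, ‖x j‖ ^ 2 + ∑ i, ‖y i‖ ^ 2) := by
  have h1 := sum_norm_sq_mulVec_le A x
  have h0 := scalarNorm_nonneg A
  have e : ∑ i, ∑ j, star (y i) * A i j * x j = ∑ i, star (y i) * A.mulVec x i := by
    simp only [Matrix.mulVec, dotProduct, Finset.mul_sum, mul_assoc]
  rw [e]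
  set a := scalarNorm A
  set z := A.mulVec x
  have h2 : (∑ i, star (y i) * z i).re ≤ ∑ i, ‖y i‖ * ‖z i‖ := by
    rw [Complex.re_sum]
    refine Finset.sum_le_sum fun i _ => (Complex.re_le_norm _).trans ?_
    simp
  rcases h0.eq_or_lt with h0 | h0
  · have : ∑ i, ‖z i‖ ^ 2 = 0 := le_antisymm (by simpa [← h0] using h1) (by positivity)
    have hz : ∀ i, ‖z i‖ = 0 := fun i => by
      simpa using (Finset.sum_eq_zero_iff_of_nonneg (fun i _ => by positivity)).1 this i
        (Finset.mem_univ i)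
    simp only [hz, mul_zero, Finset.sum_const_zero] at h2
    rw [← h0, zero_mul]; linarith
  · have h3 : ∀ i, 2 * (‖y i‖ * ‖z i‖) ≤ a * ‖y i‖ ^ 2 + a⁻¹ * ‖z i‖ ^ 2 := fun i => by
      have : a * ‖y i‖ ^ 2 + a⁻¹ * ‖z i‖ ^ 2 - 2 * (‖y i‖ * ‖z i‖) =
        a⁻¹ * (a * ‖y i‖ - ‖z i‖) ^ 2 := by field_simp; ring
      have : 0 ≤ a⁻¹ * (a * ‖y i‖ - ‖z i‖) ^ 2 := by positivity
      linarith
    have h4 := Finset.sum_le_sum fun i (_ : i ∈ Finset.univ) => h3 i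
    rw [← Finset.mul_sum, Finset.sum_add_distrib, ← Finset.mul_sum, ← Finset.mul_sum] at h4
    have h5 : a⁻¹ * ∑ i, ‖z i‖ ^ 2 ≤ a * ∑ j, ‖x j‖ ^ 2 := by
      rw [inv_mul_le_iff₀ h0]; linarith [h1]
    linarith

omit [DecidableEq m] in
theorem scalarNorm_le_of_form {A : Matrix m n ℂ} {r : ℝ} (hr : 0 ≤ r)
    (h : ∀ (x : n → ℂ) (y : m → ℂ), 2 * (∑ i, ∑ j, star (y i) * A i j * x j).re ≤
      r * (∑ j, ‖x j‖ ^ 2 + ∑ i, ‖y i‖ ^ 2)) : scalarNorm A ≤ r := by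
  refine le_of_forall_pos_le_add fun ε hε => ?_
  have hs : 0 < r + ε := by positivity
  set s := r + ε
  refine scalarNorm_le_of_mulVec hs.le fun x => ?_
  -- The optimal test vector is a multiple of $Ax$. Working with $s=r+\varepsilon$ keeps the
  -- division legitimate when $r=0$.
  have h1 := h x (fun i => (s : ℂ)⁻¹ * A.mulVec x i)
  have e : ∑ i, ∑ j, star ((s : ℂ)⁻¹ * A.mulVec x i) * A i j * x j
      = ((s⁻¹ * ∑ i, ‖A.mulVec x i‖ ^ 2 : ℝ) : ℂ) := by
    push_cast
    rw [Finset.mul_sum]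
    refine Finset.sum_congr rfl fun i _ => ?_
    simp only [mul_assoc, ← Finset.mul_sum]
    have : ∑ j, A i j * x j = A.mulVec x i := rfl
    rw [this, star_mul', star_inv₀]
    simp only [RCLike.star_def, Complex.conj_ofReal, mul_assoc]
    rw [Complex.conj_mul']
  rw [e, Complex.ofReal_re] at h1
  simp only [norm_mul, mul_pow, norm_inv, Complex.norm_real, Real.norm_eq_abs, abs_of_pos hs,
    ← Finset.mul_sum] at h1
  set S := ∑ i, ‖A.mulVec x i‖ ^ 2
  have hS : 0 ≤ S := by positivity
  have h2 : r * (∑ j, ‖x j‖ ^ 2 + s⁻¹ ^ 2 * S) ≤ s * (∑ j, ‖x j‖ ^ 2 + s⁻¹ ^ 2 * S) :=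
    mul_le_mul_of_nonneg_right (by simp [s, hε.le]) (by positivity)
  have h3 : s * (s⁻¹ ^ 2 * S) = s⁻¹ * S := by field_simp
  have h4 : s⁻¹ * S ≤ s * ∑ j, ‖x j‖ ^ 2 := by linarith
  rw [inv_mul_le_iff₀ hs] at h4
  linarith

omit [DecidableEq m] in
theorem scalarNorm_submatrix_le {m' n' : Type*} [Fintype m'] [Fintype n'] [DecidableEq n']
    (A : Matrix m n ℂ) {f : m' → m} {g : n' → n} (hf : f.Injective) (hg : g.Injective) :
    scalarNorm (A.submatrix f g) ≤ scalarNorm A := by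
  classical
  refine scalarNorm_le_of_form (scalarNorm_nonneg A) fun x y => ?_
  have h := two_mul_re_form_le A (Function.extend g x 0) (Function.extend f y 0)
  have sumf : ∀ F : m → ℝ, (∀ i ∉ Set.range f, F i = 0) → ∑ i, F i = ∑ i, F (f i) := fun F hF =>
    (Fintype.sum_of_injective f hf _ _ (fun i hi => hF i hi) fun _ => rfl).symm
  have e1 : ∑ i, ‖Function.extend f y 0 i‖ ^ 2 = ∑ i, ‖y i‖ ^ 2 :=
    (Fintype.sum_of_injective f hf _ _
      (fun i hi => by simp [Function.extend_apply' _ _ _ (by simpa using hi)])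
      fun i => by rw [hf.extend_apply]).symm
  have e2 : ∑ i, ‖Function.extend g x 0 i‖ ^ 2 = ∑ i, ‖x i‖ ^ 2 :=
    (Fintype.sum_of_injective g hg _ _
      (fun i hi => by simp [Function.extend_apply' _ _ _ (by simpa using hi)])
      fun i => by rw [hg.extend_apply]).symm
  have e3 : ∑ i, ∑ j, star (Function.extend f y 0 i) * A i j * Function.extend g x 0 j =
      ∑ i, ∑ j, star (y i) * A.submatrix f g i j * x j :=
    (Fintype.sum_of_injective f hf _ _
      (fun i hi => by simp [Function.extend_apply' _ _ _ (by simpa using hi)])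
      fun i => by
        rw [hf.extend_apply]
        exact Fintype.sum_of_injective g hg _ _
          (fun i hi => by simp [Function.extend_apply' _ _ _ (by simpa using hi)])
          fun j => by rw [hg.extend_apply]; rfl).symm
  rwa [e1, e2, e3] at h

omit [DecidableEq m] in
theorem scalarNorm_one_kronecker_le {κ : Type*} [Fintype κ] [DecidableEq κ] (A : Matrix m n ℂ) :
    scalarNorm (Matrix.kroneckerMap (· * ·) (1 : Matrix κ κ ℂ) A) ≤ scalarNorm A := by
  refine scalarNorm_le_of_form (scalarNorm_nonneg A) fun x y => ?_
  have h := Finset.sum_le_sum fun c (_ : c ∈ (Finset.univ : Finset κ)) =>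
    two_mul_re_form_le A (fun j => x (c, j)) (fun i => y (c, i))
  rw [← Finset.mul_sum, ← Finset.mul_sum, Finset.sum_add_distrib, ← Complex.re_sum] at h
  simp only [Fintype.sum_prod_type, Matrix.kroneckerMap_apply]
  refine le_of_eq_of_le ?_ h
  refine congrArg (fun z : ℂ => 2 * z.re)
    (Finset.sum_congr rfl fun c _ => Finset.sum_congr rfl fun i _ => ?_)
  rw [Finset.sum_eq_single c]
  · simp
  · intro d _ hd; simp [Matrix.one_apply_ne hd.symm]
  · simp

end ScalarNormLemmas

/-! ### Algebra of direct sums and two-sided scalar products. -/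

namespace Matrix

variable {E F : Type*} [AddCommGroup E] [AddCommGroup F] {m n : ℕ}

theorem dirSum_castAdd_castAdd (v : Matrix (Fin m) (Fin m) E) (w : Matrix (Fin n) (Fin n) E) (i j) :
    dirSum v w (Fin.castAdd n i) (Fin.castAdd n j) = v i j := by simp [dirSum]

theorem dirSum_natAdd_natAdd (v : Matrix (Fin m) (Fin m) E) (w : Matrix (Fin n) (Fin n) E) (i j) :
    dirSum v w (Fin.natAdd m i) (Fin.natAdd m j) = w i j := by simp [dirSum]

theorem dirSum_castAdd_natAdd (v : Matrix (Fin m) (Fin m) E) (w : Matrix (Fin n) (Fin n) E) (i j) :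
    dirSum v w (Fin.castAdd n i) (Fin.natAdd m j) = 0 := by simp [dirSum]

theorem dirSum_natAdd_castAdd (v : Matrix (Fin m) (Fin m) E) (w : Matrix (Fin n) (Fin n) E) (i j) :
    dirSum v w (Fin.natAdd m i) (Fin.castAdd n j) = 0 := by simp [dirSum]

theorem dirSum_map (v : Matrix (Fin m) (Fin m) E)
    (w : Matrix (Fin n) (Fin n) E) (φ : E → F) (h : φ 0 = 0) :
    (dirSum v w).map φ = dirSum (v.map φ) (w.map φ) := by
  ext i j
  refine Fin.addCases (fun i => ?_) (fun i => ?_) i <;>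
  refine Fin.addCases (fun j => ?_) (fun j => ?_) j <;>
  simp [dirSum, h]

theorem dirSum_add (v v' : Matrix (Fin m) (Fin m) E) (w w' : Matrix (Fin n) (Fin n) E) :
    dirSum (v + v') (w + w') = dirSum v w + dirSum v' w' := by
  ext i j
  refine Fin.addCases (fun i => ?_) (fun i => ?_) i <;>
  refine Fin.addCases (fun j => ?_) (fun j => ?_) j <;>
  simp [dirSum]

theorem dirSum_submatrix_left (v : Matrix (Fin m) (Fin m) E) (w : Matrix (Fin n) (Fin n) E) :
    (dirSum v w).submatrix (Fin.castAdd n) (Fin.castAdd n) = v := by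
  ext i j; simp [dirSum_castAdd_castAdd]

theorem dirSum_submatrix_right (v : Matrix (Fin m) (Fin m) E) (w : Matrix (Fin n) (Fin n) E) :
    (dirSum v w).submatrix (Fin.natAdd m) (Fin.natAdd m) = w := by
  ext i j; simp [dirSum_natAdd_natAdd]

variable [Module ℂ E] [Module ℂ F]

theorem biact_add (α : Matrix (Fin n) (Fin m) ℂ) (v w : Matrix (Fin m) (Fin m) E)
    (β : Matrix (Fin m) (Fin n) ℂ) : biact α (v + w) β = biact α v β + biact α w β := by
  ext i j; simp [biact, Finset.sum_add_distrib]

theorem biact_smul (α : Matrix (Fin n) (Fin m) ℂ) (c : ℂ) (v : Matrix (Fin m) (Fin m) E)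
    (β : Matrix (Fin m) (Fin n) ℂ) : biact α (c • v) β = c • biact α v β := by
  ext i j; simp only [biact, smul_apply, Finset.smul_sum, smul_smul]
  simp only [mul_comm c]

theorem smul_biact (α : Matrix (Fin n) (Fin m) ℂ) (c : ℂ) (v : Matrix (Fin m) (Fin m) E)
    (β : Matrix (Fin m) (Fin n) ℂ) : biact (c • α) v β = c • biact α v β := by
  ext i j; simp only [biact, smul_apply, Finset.smul_sum, smul_smul, smul_eq_mul, mul_assoc]

theorem biact_smul_right (α : Matrix (Fin n) (Fin m) ℂ) (c : ℂ) (v : Matrix (Fin m) (Fin m) E)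
    (β : Matrix (Fin m) (Fin n) ℂ) : biact α v (c • β) = c • biact α v β := by
  ext i j
  simp only [biact, smul_apply, Finset.smul_sum, smul_smul, smul_eq_mul, mul_left_comm c]

theorem map_biact (φ : E →ₗ[ℂ] F) (α : Matrix (Fin n) (Fin m) ℂ) (v : Matrix (Fin m) (Fin m) E)
    (β : Matrix (Fin m) (Fin n) ℂ) : (biact α v β).map φ = biact α (v.map φ) β := by
  ext i j; simp [biact]

theorem biact_one_one (v : Matrix (Fin n) (Fin n) E) : biact 1 v 1 = v := by
  ext i j
  simp [biact, Matrix.one_apply]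

/-- The `0`-`1` matrix which implements a selection of coordinates. -/
def selector (f : Fin n → Fin m) : Matrix (Fin n) (Fin m) ℂ := (1 : Matrix (Fin m) (Fin m) ℂ).submatrix f id

theorem selector_apply (f : Fin n → Fin m) (i : Fin n) (j : Fin m) :
    selector f i j = if f i = j then 1 else 0 := by
  simp [selector, Matrix.one_apply]

theorem biact_selector (f g : Fin n → Fin m) (v : Matrix (Fin m) (Fin m) E) :
    biact (selector f) v (selector g).transpose = v.submatrix f g := by
  ext i j; simp [biact, selector_apply]

theorem scalarNorm_one_le : scalarNorm (1 : Matrix (Fin n) (Fin n) ℂ) ≤ 1 := by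
  rw [← diagonal_one]; exact scalarNorm_diagonal_le zero_le_one (by simp)

theorem scalarNorm_selector_le {f : Fin n → Fin m} (hf : f.Injective) :
    scalarNorm (selector f) ≤ 1 :=
  (scalarNorm_submatrix_le _ hf Function.injective_id).trans scalarNorm_one_le

theorem scalarNorm_selector_transpose_le {f : Fin n → Fin m} (hf : f.Injective) :
    scalarNorm (selector f).transpose ≤ 1 := by
  have : (selector f).transpose = (1 : Matrix (Fin m) (Fin m) ℂ).submatrix id f := by
    ext i j; simp [selector, Matrix.one_apply, eq_comm]
  rw [this]
  exact (scalarNorm_submatrix_le _ Function.injective_id hf).trans scalarNorm_one_le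

/-- The row `[α, β]` of two matrices. -/
def rowPair {p : ℕ} (α : Matrix (Fin n) (Fin m) ℂ) (β : Matrix (Fin n) (Fin p) ℂ) :
    Matrix (Fin n) (Fin (m + p)) ℂ := of fun i => Fin.append (α i) (β i)

theorem rowPair_mul_conjTranspose {p : ℕ} (α : Matrix (Fin n) (Fin m) ℂ) (β : Matrix (Fin n) (Fin p) ℂ) :
    rowPair α β * (rowPair α β).conjTranspose = α * α.conjTranspose + β * β.conjTranspose := by
  ext i j
  simp [rowPair, mul_apply, Fin.sum_univ_add]

theorem biact_rowPair_dirSum {p q : ℕ} (α₁ : Matrix (Fin n) (Fin p) ℂ) (α₂ : Matrix (Fin n) (Fin q) ℂ)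
    (v₁ : Matrix (Fin p) (Fin p) E) (v₂ : Matrix (Fin q) (Fin q) E)
    (β₁ : Matrix (Fin n) (Fin p) ℂ) (β₂ : Matrix (Fin n) (Fin q) ℂ) :
    biact (rowPair α₁ α₂) (dirSum v₁ v₂) (rowPair β₁ β₂).conjTranspose =
      biact α₁ v₁ β₁.conjTranspose + biact α₂ v₂ β₂.conjTranspose := by
  ext i j
  simp [biact, rowPair, Fin.sum_univ_add, dirSum_castAdd_castAdd, dirSum_natAdd_natAdd,
    dirSum_castAdd_natAdd, dirSum_natAdd_castAdd]

end Matrix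

/-! ### First consequences of the axioms of Ruan. -/

namespace OperatorSpace

open Matrix

variable {V : Type*} [NormedAddCommGroup V] [NormedSpace ℂ V] [OperatorSpace V]
variable {W : Type*} [NormedAddCommGroup W] [NormedSpace ℂ W] [OperatorSpace W]

theorem le_mul_of_le_on_unit_ball {E : Type*} [AddCommGroup E] [Module ℂ E] {f g : E → ℝ}
    (hf : ∀ (c : ℂ) x, f (c • x) = ‖c‖ * f x) (hg : ∀ (c : ℂ) x, g (c • x) = ‖c‖ * g x)
    (hg0 : ∀ x, 0 ≤ g x) {r : ℝ} (h : ∀ x, g x ≤ 1 → f x ≤ r) (x : E) : f x ≤ r * g x := by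
  rcases (hg0 x).eq_or_lt with h0 | h0
  · rw [← h0, mul_zero]
    by_contra! hx
    -- All multiples of $x$ lie in the unit ball of $g$; this one has $f$-value $|r|+1>r$.
    have h1 := h (((|r| + 1) / f x : ℝ) • x) (by
      have := hg (((|r| + 1) / f x : ℝ) : ℂ) x
      rw [← h0, mul_zero] at this
      exact this.le.trans zero_le_one)
    have h2 := hf (((|r| + 1) / f x : ℝ) : ℂ) x
    rw [Complex.norm_real, Real.norm_of_nonneg (by positivity), div_mul_cancel₀ _ hx.ne'] at h2
    have := h2.symm.le.trans h1
    linarith [le_abs_self r]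
  · have h1 := h (((g x)⁻¹ : ℝ) • x) (by
      have := hg (((g x)⁻¹ : ℝ) : ℂ) x
      rw [Complex.norm_real, norm_inv, Real.norm_eq_abs, abs_of_pos h0, inv_mul_cancel₀ h0.ne']
        at this
      exact this.le)
    have h2 := hf (((g x)⁻¹ : ℝ) : ℂ) x
    rw [Complex.norm_real, norm_inv, Real.norm_eq_abs, abs_of_pos h0] at h2
    have := h2.symm.le.trans h1
    rw [inv_mul_le_iff₀ h0] at this
    linarith

theorem mnorm_zero (n : ℕ) : mnorm n (0 : Matrix (Fin n) (Fin n) V) = 0 := by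
  simpa using mnorm_smul n 0 (0 : Matrix (Fin n) (Fin n) V)

theorem mnorm_neg (n : ℕ) (v : Matrix (Fin n) (Fin n) V) : mnorm n (-v) = mnorm n v := by
  simpa using mnorm_smul n (-1) v

theorem mnorm_nonneg (n : ℕ) (v : Matrix (Fin n) (Fin n) V) : 0 ≤ mnorm n v := by
  have := mnorm_add_le n v (-v)
  rw [add_neg_cancel, mnorm_zero, mnorm_neg] at this
  linarith

theorem mnorm_sub_le (n : ℕ) (v w : Matrix (Fin n) (Fin n) V) :
    mnorm n (v - w) ≤ mnorm n v + mnorm n w := by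
  rw [sub_eq_add_neg, ← mnorm_neg n w]; exact mnorm_add_le n _ _

theorem mnorm_sub_rev (n : ℕ) (v w : Matrix (Fin n) (Fin n) V) :
    mnorm n (v - w) = mnorm n (w - v) := by rw [← mnorm_neg, neg_sub]

theorem mnorm_eq_zero {n : ℕ} {v : Matrix (Fin n) (Fin n) V} : mnorm n v = 0 ↔ v = 0 :=
  ⟨eq_zero_of_mnorm_eq_zero n v, fun h => by rw [h, mnorm_zero]⟩

/-- The space `M_n(V)` as a normed space. -/
def NormedMatrix (V : Type*) (n : ℕ) : Type _ := Matrix (Fin n) (Fin n) V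

namespace NormedMatrix

instance (n : ℕ) : AddCommGroup (NormedMatrix V n) :=
  inferInstanceAs (AddCommGroup (Matrix (Fin n) (Fin n) V))

instance (n : ℕ) : Module ℂ (NormedMatrix V n) :=
  inferInstanceAs (Module ℂ (Matrix (Fin n) (Fin n) V))

noncomputable instance (n : ℕ) : Norm (NormedMatrix V n) := ⟨mnorm n⟩

noncomputable instance (n : ℕ) : NormedAddCommGroup (NormedMatrix V n) :=
  NormedAddCommGroup.ofCore (𝕜 := ℂ)
    { norm_nonneg := mnorm_nonneg n
      norm_smul := mnorm_smul n
      norm_triangle := mnorm_add_le n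
      norm_eq_zero_iff := fun _ => mnorm_eq_zero }

instance (n : ℕ) : NormedSpace ℂ (NormedMatrix V n) := ⟨fun c u => (mnorm_smul n c u).le⟩

end NormedMatrix

theorem exists_norming_functional {n : ℕ} (v : Matrix (Fin n) (Fin n) V) :
    ∃ F : Matrix (Fin n) (Fin n) V →ₗ[ℂ] ℂ, (∀ u, ‖F u‖ ≤ mnorm n u) ∧ F v = mnorm n v := by
  obtain ⟨g, hg, hv⟩ := exists_dual_vector'' ℂ (show NormedMatrix V n from v)
  exact ⟨g.toLinearMap, fun u => (g.le_of_opNorm_le hg u).trans (one_mul _).le, hv⟩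

theorem mnorm_biact_le_of_le {m n : ℕ} {α : Matrix (Fin n) (Fin m) ℂ} {v : Matrix (Fin m) (Fin m) V}
    {β : Matrix (Fin m) (Fin n) ℂ} {a b r : ℝ} (hα : scalarNorm α ≤ a) (hv : mnorm m v ≤ r)
    (hβ : scalarNorm β ≤ b) : mnorm n (biact α v β) ≤ a * r * b := by
  have := scalarNorm_nonneg α
  have := scalarNorm_nonneg β
  have := mnorm_nonneg m v
  have h1 : 0 ≤ a := by linarith
  have h2 : 0 ≤ a * r := mul_nonneg h1 (by linarith)
  exact (mnorm_biact_le m n α v β).trans (by gcongr)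

theorem mnorm_submatrix_le {m n : ℕ} (v : Matrix (Fin m) (Fin m) V) {f g : Fin n → Fin m}
    (hf : f.Injective) (hg : g.Injective) : mnorm n (v.submatrix f g) ≤ mnorm m v := by
  rw [← biact_selector]
  simpa using mnorm_biact_le_of_le (scalarNorm_selector_le hf) (le_refl (mnorm m v))
    (scalarNorm_selector_transpose_le hg)

theorem norm_entry_le_mnorm {n : ℕ} (v : Matrix (Fin n) (Fin n) V) (i j : Fin n) :
    ‖v i j‖ ≤ mnorm n v := by
  rw [← mnorm_one]
  exact mnorm_submatrix_le v (f := fun _ : Fin 1 => i) (g := fun _ : Fin 1 => j)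
    (Function.injective_of_subsingleton _) (Function.injective_of_subsingleton _)

theorem mnorm_sum_le {ι : Type*} (s : Finset ι) {n : ℕ} (v : ι → Matrix (Fin n) (Fin n) V) :
    mnorm n (∑ i ∈ s, v i) ≤ ∑ i ∈ s, mnorm n (v i) := by
  classical
  induction s using Finset.induction_on with
  | empty => simp [mnorm_zero]
  | insert i s hi ih =>
    rw [Finset.sum_insert hi, Finset.sum_insert hi]
    exact (mnorm_add_le _ _ _).trans (by gcongr)

theorem mnorm_diagonal_le (n : ℕ) (v : V) :
    mnorm n (Matrix.diagonal fun _ : Fin n => v) ≤ ‖v‖ := by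
  induction n with
  | zero =>
    have : (Matrix.diagonal fun _ : Fin 0 => v) = 0 := by ext i; exact i.elim0
    rw [this, mnorm_zero]; positivity
  | succ n ih =>
    have : (Matrix.diagonal fun _ : Fin (n + 1) => v) =
        dirSum (Matrix.diagonal fun _ : Fin n => v) (Matrix.of fun _ _ : Fin 1 => v) := by
      ext i j
      refine Fin.addCases (fun i => ?_) (fun i => ?_) i <;>
      refine Fin.addCases (fun j => ?_) (fun j => ?_) j
      · simp [dirSum_castAdd_castAdd, Matrix.diagonal_apply]
      · simp only [dirSum_castAdd_natAdd]; rw [Matrix.diagonal_apply_ne]; simp [Fin.ext_iff]; omega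
      · simp only [dirSum_natAdd_castAdd]; rw [Matrix.diagonal_apply_ne]; simp [Fin.ext_iff]; omega
      · simp only [dirSum_natAdd_natAdd]; simp [Matrix.diagonal_apply, Fin.ext_iff]
    rw [this, mnorm_dirSum, mnorm_one]
    exact max_le ih le_rfl

theorem mnorm_map_smul_le {n : ℕ} (a : Matrix (Fin n) (Fin n) ℂ) (v : V) :
    mnorm n (a.map (· • v)) ≤ scalarNorm a * ‖v‖ := by
  have : a.map (· • v) = biact a (Matrix.diagonal fun _ => v) 1 := by
    ext i j
    simp only [biact, Matrix.map_apply, Matrix.one_apply, Matrix.diagonal_apply, mul_ite, mul_one,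
      mul_zero, ite_smul, zero_smul, smul_ite, smul_zero]
    simp
  rw [this]
  simpa using mnorm_biact_le_of_le (le_refl (scalarNorm a)) (mnorm_diagonal_le n v) scalarNorm_one_le

/-- Bounded functionals are completely bounded with the same constant: $\langle
f_n(v)x,y\rangle=f(y^*vx)$, and $y^*vx$ is a $1\times1$ matrix of norm at most
$\|y\|\,\|v\|\,\|x\|$. -/
theorem scalarNorm_map_le (f : V →ₗ[ℂ] ℂ) {C : ℝ} (hC : 0 ≤ C) (hf : ∀ v, ‖f v‖ ≤ C * ‖v‖) {n : ℕ}
    (v : Matrix (Fin n) (Fin n) V) : scalarNorm (v.map f) ≤ C * mnorm n v := by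
  have hm := mnorm_nonneg n v
  refine scalarNorm_le_of_form (by positivity) fun x y => ?_
  have cx : ∀ x : Fin n → ℂ, scalarNorm (Matrix.of fun i (_ : Fin 1) => x i) ≤ √(∑ i, ‖x i‖ ^ 2) := by
    intro x
    refine scalarNorm_le_of_mulVec (by positivity) fun z => ?_
    rw [Real.sq_sqrt (by positivity)]
    simp [Matrix.mulVec, dotProduct, mul_pow, Finset.sum_mul]
  have cy : scalarNorm (Matrix.of fun (_ : Fin 1) i => star (y i)) ≤ √(∑ i, ‖y i‖ ^ 2) := by
    refine le_trans (le_of_eq ?_) (cx y)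
    rw [← scalarNorm_conjTranspose]; congr 1; ext; simp
  have h := mnorm_biact_le_of_le cy (le_refl (mnorm n v)) (cx x)
  set X := ∑ i, ‖x i‖ ^ 2
  set Y := ∑ i, ‖y i‖ ^ 2
  have e : ∑ i, ∑ j, star (y i) * v.map f i j * x j =
      f (biact (Matrix.of fun (_ : Fin 1) i => star (y i)) v (Matrix.of fun i (_ : Fin 1) => x i) 0 0) := by
    simp only [biact, map_sum, map_smul, smul_eq_mul, Matrix.map_apply, Matrix.of_apply]
    refine Finset.sum_congr rfl fun i _ => Finset.sum_congr rfl fun j _ => by ring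
  have h2 := (Complex.re_le_norm _).trans ((hf _).trans
    (mul_le_mul_of_nonneg_left ((norm_entry_le_mnorm _ 0 0).trans h) hC))
  rw [e]
  have h3 : 2 * (√Y * √X) ≤ X + Y := by
    have hX : √X ^ 2 = X := Real.sq_sqrt (by positivity)
    have hY : √Y ^ 2 = Y := Real.sq_sqrt (by positivity)
    nlinarith [sq_nonneg (√X - √Y)]
  have h4 := mul_le_mul_of_nonneg_left h3 (mul_nonneg hC hm)
  linarith

theorem mnorm_map_le_cbNorm {φ : W →ₗ[ℂ] V} {C : ℝ} (hC : 0 ≤ C) (h : cbNorm φ ≤ ENNReal.ofReal C)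
    {n : ℕ} (w : Matrix (Fin n) (Fin n) W) : mnorm n (w.map φ) ≤ C * mnorm n w := by
  refine le_mul_of_le_on_unit_ball (f := fun u : Matrix (Fin n) (Fin n) W => mnorm n (u.map φ))
    (fun c u => ?_) (mnorm_smul n) (mnorm_nonneg n) (fun u hu => ?_) w
  · rw [Matrix.map_smul φ c (map_smul φ c), mnorm_smul]
  · rw [← ENNReal.ofReal_le_ofReal_iff hC]
    refine le_trans ?_ h
    exact le_iSup_of_le n (le_iSup₂ (f := fun (w : Matrix (Fin n) (Fin n) W) (_ : mnorm n w ≤ 1) =>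
      ENNReal.ofReal (mnorm n (w.map φ))) u hu)

theorem cbNorm_le {φ : W →ₗ[ℂ] V} {C : ℝ≥0∞}
    (h : ∀ n (w : Matrix (Fin n) (Fin n) W), mnorm n w ≤ 1 → ENNReal.ofReal (mnorm n (w.map φ)) ≤ C) :
    cbNorm φ ≤ C := iSup_le fun n => iSup₂_le fun w hw => h n w hw

theorem isCompletelyBounded_of_bound {φ : W →ₗ[ℂ] V} (C : ℝ)
    (h : ∀ n (w : Matrix (Fin n) (Fin n) W), mnorm n w ≤ 1 → mnorm n (w.map φ) ≤ C) :
    IsCompletelyBounded φ :=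
  (cbNorm_le fun n w hw => ENNReal.ofReal_le_ofReal (h n w hw)).trans_lt ENNReal.ofReal_lt_top

theorem IsCompletelyBounded.exists_bound {φ : W →ₗ[ℂ] V} (h : IsCompletelyBounded φ) :
    ∃ C : ℝ, 0 ≤ C ∧ ∀ n (w : Matrix (Fin n) (Fin n) W), mnorm n (w.map φ) ≤ C * mnorm n w :=
  ⟨(cbNorm φ).toReal, ENNReal.toReal_nonneg, fun _ w => mnorm_map_le_cbNorm ENNReal.toReal_nonneg
    (by rw [ENNReal.ofReal_toReal h.ne]) w⟩

theorem infNorm_le_iff {x : Matrix ℕ ℕ V} {C : ℝ} (hC : 0 ≤ C) :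
    infNorm x ≤ ENNReal.ofReal C ↔ ∀ n, mnorm n (corner n x) ≤ C := by
  simp only [infNorm, iSup_le_iff, ENNReal.ofReal_le_ofReal_iff hC]

end OperatorSpace

/-! ### Densities of positive functionals on matrix algebras. -/

section PositiveFunctional

open Matrix
open scoped ComplexOrder MatrixOrder Matrix.Norms.L2Operator

/-- A positive functional on `M_k` perturbed by a multiple of the trace is given by an invertible
density `Rᴴ R`. -/
theorem Matrix.exists_isUnit_sum_norm_sq_mulVec {k : ℕ} (p : Matrix (Fin k) (Fin k) ℂ →ₗ[ℝ] ℝ)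
    (hp : ∀ x : Fin k → ℂ, 0 ≤ p (vecMulVec x (star x))) {δ : ℝ} (hδ : 0 < δ) :
    ∃ R : Matrix (Fin k) (Fin k) ℂ, IsUnit R ∧ ∀ x : Fin k → ℂ,
      ∑ i, ‖(R *ᵥ x) i‖ ^ 2 = p (vecMulVec x (star x)) + δ * ∑ i, ‖x i‖ ^ 2 := by
  set G : Matrix (Fin k) (Fin k) ℂ :=
    of fun i j => (p (single j i 1) : ℂ) - Complex.I * p (single j i Complex.I) with hG
  have hpG : ∀ a, p a = (∑ i, ∑ j, G j i * a i j).re := fun a => by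
    conv_lhs => rw [matrix_eq_sum_single a]
    simp only [map_sum, Complex.re_sum]
    refine Finset.sum_congr rfl fun i _ => Finset.sum_congr rfl fun j _ => ?_
    have : single i j (a i j) =
        (a i j).re • single i j (1 : ℂ) + (a i j).im • single i j Complex.I := by
      rw [smul_single, smul_single, ← single_add]
      congr 1
      simp [Complex.re_add_im]
    rw [this, map_add, map_smul, map_smul]
    simp [hG, mul_comm]
  have hx : ∀ x : Fin k → ℂ, p (vecMulVec x (star x)) = (star x ⬝ᵥ (G *ᵥ x)).re := fun x => by
    rw [hpG, Finset.sum_comm]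
    simp only [dotProduct, mulVec, Finset.mul_sum, vecMulVec_apply]
    refine congrArg Complex.re (Finset.sum_congr rfl fun i _ => Finset.sum_congr rfl fun j _ => ?_)
    ring
  have hx' : ∀ x : Fin k → ℂ, p (vecMulVec x (star x)) = (star x ⬝ᵥ (Gᴴ *ᵥ x)).re := fun x => by
    rw [hx, star_dotProduct, star_mulVec, ← dotProduct_mulVec]
    exact Complex.conj_re _
  -- Here $p(a)=\mathrm{Re}\,\mathrm{tr}(Ga)$. As $p$ is only real linear, $G$ need not be
  -- Hermitian, but its Hermitian part gives the same values on the matrices $xx^*$. The term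
  -- $\delta$ makes $P$ definite, hence $R$ invertible.
  set P : Matrix (Fin k) (Fin k) ℂ := (1 / 2 : ℝ) • (G + Gᴴ) + δ • 1 with hP
  have hPx : ∀ x : Fin k → ℂ, (star x ⬝ᵥ (P *ᵥ x)).re =
      p (vecMulVec x (star x)) + δ * ∑ i, ‖x i‖ ^ 2 := fun x => by
    simp only [hP, add_mulVec, smul_mulVec, dotProduct_add, dotProduct_smul, one_mulVec,
      Complex.add_re, Complex.smul_re, ← hx, ← hx', smul_eq_mul]
    have : (star x ⬝ᵥ x).re = ∑ i, ‖x i‖ ^ 2 := by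
      simp only [dotProduct, Complex.re_sum, Pi.star_apply, RCLike.star_def, Complex.conj_mul']
      norm_cast
    rw [this]; ring
  have hPh : P.IsHermitian := by
    simp [IsHermitian, hP, conjTranspose_add, add_comm]
  have hpd : P.PosDef := by
    refine PosDef.of_dotProduct_mulVec_pos hPh fun x hx0 => ?_
    rw [Complex.pos_iff]
    refine ⟨?_, ?_⟩
    · rw [hPx]
      have : 0 < ∑ i, ‖x i‖ ^ 2 := by
        obtain ⟨i, hi⟩ := Function.ne_iff.1 hx0
        exact Finset.sum_pos' (fun i _ => by positivity) ⟨i, Finset.mem_univ i, by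
          have := norm_pos_iff.2 hi; positivity⟩
      have := hp x
      positivity
    · exact (hPh.im_star_dotProduct_mulVec_self x).symm
  obtain ⟨R, hR, e⟩ := CStarAlgebra.isStrictlyPositive_iff_eq_star_mul_self.mp
    hpd.isStrictlyPositive
  refine ⟨R, hR, fun x => ?_⟩
  rw [← hPx, e, ← mulVec_mulVec, dotProduct_mulVec, star_eq_conjTranspose, ← star_mulVec]
  simp only [dotProduct, Complex.re_sum, Pi.star_apply, RCLike.star_def, Complex.conj_mul']
  norm_cast

theorem Matrix.exists_isUnit_sum_norm_sq_mul {k : ℕ} (p : Matrix (Fin k) (Fin k) ℂ →ₗ[ℝ] ℝ)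
    (hp : ∀ x : Fin k → ℂ, 0 ≤ p (vecMulVec x (star x))) {δ : ℝ} (hδ : 0 < δ) :
    ∃ R : Matrix (Fin k) (Fin k) ℂ, IsUnit R ∧ ∀ (m : ℕ) (γ : Matrix (Fin k) (Fin m) ℂ),
      ∑ c, ∑ i, ‖(R * γ) i c‖ ^ 2 = p (γ * γᴴ) + δ * ∑ c, ∑ i, ‖γ i c‖ ^ 2 := by
  obtain ⟨R, hR, h⟩ := exists_isUnit_sum_norm_sq_mulVec p hp hδ
  refine ⟨R, hR, fun m γ => ?_⟩
  have e : γ * γᴴ = ∑ c, vecMulVec (fun i => γ i c) (star fun i => γ i c) := by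
    ext i j; simp [mul_apply, sum_apply, vecMulVec_apply]
  rw [e, map_sum, Finset.mul_sum, ← Finset.sum_add_distrib]
  exact Finset.sum_congr rfl fun c _ => h _

end PositiveFunctional

/-! ### Complete contractions into $M_k$ that detect the norm of $M_k(V)$. -/

namespace OperatorSpace

open Matrix

variable {V : Type*} [NormedAddCommGroup V] [NormedSpace ℂ V] [OperatorSpace V]

/-- Every contractive functional on `M_k(V)` is dominated by a pair of positive functionals
on `M_k`. -/
theorem exists_positive_majorants {k : ℕ} (F : Matrix (Fin k) (Fin k) V →ₗ[ℂ] ℂ)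
    (hF : ∀ u, ‖F u‖ ≤ mnorm k u) :
    ∃ p q : Matrix (Fin k) (Fin k) ℂ →ₗ[ℝ] ℝ, p 1 ≤ 1 ∧ q 1 ≤ 1 ∧
      ∀ (m : ℕ) (α γ : Matrix (Fin k) (Fin m) ℂ) (v : Matrix (Fin m) (Fin m) V), mnorm m v ≤ 1 →
        2 * (F (biact α v γᴴ)).re ≤ p (α * αᴴ) + q (γ * γᴴ) := by
  let I := {t : Σ m : ℕ, Matrix (Fin k) (Fin m) ℂ × Matrix (Fin k) (Fin m) ℂ ×
    Matrix (Fin m) (Fin m) V // mnorm t.1 t.2.2.2 ≤ 1}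
  let mk : ∀ (m : ℕ) (α γ : Matrix (Fin k) (Fin m) ℂ) (v : Matrix (Fin m) (Fin m) V),
    mnorm m v ≤ 1 → I := fun m α γ v hv => ⟨⟨m, α, γ, v⟩, hv⟩
  -- The infimum $N$ of these values is sublinear, and any linear $L\le N$ on pairs of matrices
  -- splits into the required $p$ and $q$.
  let val : Matrix (Fin k) (Fin k) ℂ × Matrix (Fin k) (Fin k) ℂ → I → ℝ := fun a t =>
    scalarNorm (a.1 + t.1.2.1 * t.1.2.1ᴴ) + scalarNorm (a.2 + t.1.2.2.1 * t.1.2.2.1ᴴ) -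
      2 * (F (biact t.1.2.1 t.1.2.2.2 t.1.2.2.1ᴴ)).re
  let i₀ : I := mk 0 0 0 0 (by rw [mnorm_zero]; exact zero_le_one)
  have : Nonempty I := ⟨i₀⟩
  let N := fun a => ⨅ t, val a t
  have lower : ∀ a t, -(scalarNorm a.1 + scalarNorm a.2) ≤ val a t := by
    -- The infimum is finite because $2\,\mathrm{Re}\,F(\alpha v\gamma^*)\le
    -- 2\|\alpha\|\|\gamma\|\le\|\alpha\|^2+\|\gamma\|^2$.
    rintro a ⟨⟨m, α, γ, v⟩, hv⟩
    have h1 : (F (biact α v γᴴ)).re ≤ scalarNorm α * 1 * scalarNorm γᴴ :=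
      (Complex.re_le_norm _).trans ((hF _).trans (mnorm_biact_le_of_le le_rfl hv le_rfl))
    rw [scalarNorm_conjTranspose] at h1
    have h2 : ∀ b (α : Matrix (Fin k) (Fin m) ℂ),
        scalarNorm α ^ 2 ≤ scalarNorm (b + α * αᴴ) + scalarNorm b := fun b α => by
      rw [← scalarNorm_mul_conjTranspose_self]
      have h := scalarNorm_add_le (b + α * αᴴ) ((-1 : ℂ) • b)
      rw [scalarNorm_smul] at h
      simpa using h
    have h3 := h2 a.1 α
    have h4 := h2 a.2 γ
    show _ ≤ scalarNorm (a.1 + α * αᴴ) + scalarNorm (a.2 + γ * γᴴ) - 2 * (F (biact α v γᴴ)).re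
    nlinarith [sq_nonneg (scalarNorm α - scalarNorm γ)]
  have bdd : ∀ a, BddBelow (Set.range (val a)) := fun a =>
    ⟨_, by rintro _ ⟨t, rfl⟩; exact lower a t⟩
  have N_le : ∀ a t, N a ≤ val a t := fun a t => ciInf_le (bdd a) t
  have N_smul_le : ∀ c : ℝ, 0 < c → ∀ a, N (c • a) ≤ c * N a := by
    intro c hc a
    show _ ≤ c * ⨅ t, val a t
    rw [Real.mul_iInf_of_nonneg hc.le]
    refine le_ciInf ?_
    rintro ⟨⟨m, α, γ, v⟩, hv⟩
    refine (N_le _ (mk m ((√c : ℂ) • α) ((√c : ℂ) • γ) v hv)).trans (le_of_eq ?_)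
    have sq : (√c : ℂ) * √c = (c : ℂ) := by
      rw [← Complex.ofReal_mul, Real.mul_self_sqrt hc.le]
    have e1 : ∀ (b) (α : Matrix (Fin k) (Fin m) ℂ),
        c • b + ((√c : ℂ) • α) * ((√c : ℂ) • α)ᴴ = (c : ℂ) • (b + α * αᴴ) := fun b α => by
      rw [conjTranspose_smul, RCLike.star_def, Complex.conj_ofReal, Matrix.smul_mul, Matrix.mul_smul,
        smul_smul, sq, smul_add]
      rfl
    have e2 : biact ((√c : ℂ) • α) v ((√c : ℂ) • γ)ᴴ = (c : ℂ) • biact α v γᴴ := by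
      rw [conjTranspose_smul, RCLike.star_def, Complex.conj_ofReal, smul_biact, biact_smul_right,
        smul_smul, sq]
    show scalarNorm (c • a.1 + ((√c : ℂ) • α) * ((√c : ℂ) • α)ᴴ) +
      scalarNorm (c • a.2 + ((√c : ℂ) • γ) * ((√c : ℂ) • γ)ᴴ) -
      2 * (F (biact ((√c : ℂ) • α) v ((√c : ℂ) • γ)ᴴ)).re = c *
      (scalarNorm (a.1 + α * αᴴ) + scalarNorm (a.2 + γ * γᴴ) - 2 * (F (biact α v γᴴ)).re)
    rw [e1, e1, e2, scalarNorm_smul, scalarNorm_smul, map_smul, smul_eq_mul, Complex.re_ofReal_mul,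
      Complex.norm_real, Real.norm_eq_abs, abs_of_pos hc]
    ring
  have N_smul : ∀ c : ℝ, 0 < c → ∀ a, N (c • a) = c * N a := fun c hc a => by
    refine le_antisymm (N_smul_le c hc a) ?_
    have := N_smul_le c⁻¹ (inv_pos.2 hc) (c • a)
    rwa [inv_smul_smul₀ hc.ne', le_inv_mul_iff₀ hc] at this
  have N_add : ∀ a b, N (a + b) ≤ N a + N b := by
    intro a b
    show _ ≤ (⨅ t, val a t) + ⨅ t, val b t
    refine le_ciInf_add_ciInf ?_
    rintro ⟨⟨m₁, α₁, γ₁, v₁⟩, hv₁⟩ ⟨⟨m₂, α₂, γ₂, v₂⟩, hv₂⟩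
    -- Two competitors merge into $[\alpha_1,\alpha_2](v_1\oplus v_2)[\gamma_1,\gamma_2]^*$. The
    -- direct sum axiom keeps the middle factor in the unit ball, which gives subadditivity.
    refine (N_le _ (mk (m₁ + m₂) (rowPair α₁ α₂) (rowPair γ₁ γ₂) (dirSum v₁ v₂)
      (by rw [mnorm_dirSum]; exact max_le hv₁ hv₂))).trans ?_
    show scalarNorm (a.1 + b.1 + rowPair α₁ α₂ * (rowPair α₁ α₂)ᴴ) +
      scalarNorm (a.2 + b.2 + rowPair γ₁ γ₂ * (rowPair γ₁ γ₂)ᴴ) -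
      2 * (F (biact (rowPair α₁ α₂) (dirSum v₁ v₂) (rowPair γ₁ γ₂)ᴴ)).re ≤
      (scalarNorm (a.1 + α₁ * α₁ᴴ) + scalarNorm (a.2 + γ₁ * γ₁ᴴ) - 2 * (F (biact α₁ v₁ γ₁ᴴ)).re) +
      (scalarNorm (b.1 + α₂ * α₂ᴴ) + scalarNorm (b.2 + γ₂ * γ₂ᴴ) - 2 * (F (biact α₂ v₂ γ₂ᴴ)).re)
    rw [biact_rowPair_dirSum, rowPair_mul_conjTranspose, rowPair_mul_conjTranspose,
      add_add_add_comm, add_add_add_comm a.2, map_add, Complex.add_re]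
    have h1 := scalarNorm_add_le (a.1 + α₁ * α₁ᴴ) (b.1 + α₂ * α₂ᴴ)
    have h2 := scalarNorm_add_le (a.2 + γ₁ * γ₁ᴴ) (b.2 + γ₂ * γ₂ᴴ)
    linarith
  obtain ⟨L, -, hL⟩ := exists_extension_of_le_sublinear
    (⊥ : (Matrix (Fin k) (Fin k) ℂ × Matrix (Fin k) (Fin k) ℂ) →ₗ.[ℝ] ℝ) N N_smul N_add (by
      rintro ⟨x, hx⟩
      obtain rfl : x = 0 := (Submodule.mem_bot ℝ).1 hx
      refine (le_of_eq ?_).trans (le_ciInf fun t => lower 0 t)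
      have : (⟨0, hx⟩ : (⊥ : (Matrix (Fin k) (Fin k) ℂ × Matrix (Fin k) (Fin k) ℂ) →ₗ.[ℝ] ℝ).domain)
        = 0 := rfl
      rw [this, LinearPMap.map_zero]
      simp [scalarNorm_zero])
  have bound : ∀ a, L a ≤ scalarNorm a.1 + scalarNorm a.2 := fun a => by
    -- The competitor with empty matrices ($m=0$) gives $N(a,b)\le\|a\|+\|b\|$, whence
    -- $p(1),q(1)\le1$.
    refine (hL a).trans ((N_le a i₀).trans (le_of_eq ?_))
    show scalarNorm (a.1 + (0 : Matrix (Fin k) (Fin 0) ℂ) * 0ᴴ) +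
      scalarNorm (a.2 + (0 : Matrix (Fin k) (Fin 0) ℂ) * 0ᴴ) - 2 * (F (biact 0 0 0ᴴ)).re = _
    have : biact (0 : Matrix (Fin k) (Fin 0) ℂ) (0 : Matrix (Fin 0) (Fin 0) V) 0ᴴ = 0 := by
      ext i j; simp [biact]
    rw [this]; simp
  refine ⟨L ∘ₗ LinearMap.inl ℝ _ _, L ∘ₗ LinearMap.inr ℝ _ _, ?_, ?_, ?_⟩
  · refine (bound _).trans ?_
    simpa [scalarNorm_zero] using scalarNorm_one_le
  · refine (bound _).trans ?_
    simpa [scalarNorm_zero] using scalarNorm_one_le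
  · intro m α γ v hv
    -- At this point both norms in the competitor $(\alpha,\gamma,v)$ vanish, so
    -- $L\le-2\,\mathrm{Re}\,F(\alpha v\gamma^*)$.
    have h := (hL (-(α * αᴴ), -(γ * γᴴ))).trans (N_le _ (mk m α γ v hv))
    have e : val (-(α * αᴴ), -(γ * γᴴ)) (mk m α γ v hv) = - (2 * (F (biact α v γᴴ)).re) := by
      show scalarNorm (-(α * αᴴ) + α * αᴴ) + scalarNorm (-(γ * γᴴ) + γ * γᴴ) - _ = _
      rw [neg_add_cancel, neg_add_cancel, scalarNorm_zero]; simp [mk]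
    have e2 : L (-(α * αᴴ), -(γ * γᴴ)) = -(L (α * αᴴ, 0) + L (0, γ * γᴴ)) := by
      rw [← map_add, ← map_neg]; simp
    rw [e, e2] at h
    simp only [LinearMap.comp_apply, LinearMap.inl_apply, LinearMap.inr_apply]
    linarith

theorem sum_sum_comm_sum_sum {ι₁ ι₂ ι₃ ι₄ M : Type*} [Fintype ι₁] [Fintype ι₂] [Fintype ι₃]
    [Fintype ι₄] [AddCommMonoid M] (f : ι₁ → ι₂ → ι₃ → ι₄ → M) :
    ∑ a, ∑ b, ∑ c, ∑ d, f a b c d = ∑ c, ∑ d, ∑ a, ∑ b, f a b c d := by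
  have h := Finset.sum_comm (s := Finset.univ) (t := Finset.univ)
    (f := fun (a : ι₁ × ι₂) (c : ι₃ × ι₄) => f a.1 a.2 c.1 c.2)
  simpa only [Fintype.sum_prod_type] using h

/-- Complete contractions into matrix algebras norm the matrices over an operator space. -/
theorem exists_norming_contraction {k : ℕ} (v₀ : Matrix (Fin k) (Fin k) V) {ε : ℝ} (hε : 0 < ε) :
    ∃ θ : V →ₗ[ℂ] Matrix (Fin k) (Fin k) ℂ,
      (∀ (m : ℕ) (v : Matrix (Fin m) (Fin m) V), mnorm m v ≤ 1 →
        scalarNorm (comp _ _ _ _ _ (v.map θ)) ≤ 1) ∧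
      mnorm k v₀ ≤ scalarNorm (comp _ _ _ _ _ (v₀.map θ)) * (1 + ε) := by
  obtain ⟨F, hF, hF0⟩ := exists_norming_functional v₀
  obtain ⟨p, q, hp1, hq1, h⟩ := exists_positive_majorants F hF
  have hpos : ∀ (r : Matrix (Fin k) (Fin k) ℂ →ₗ[ℝ] ℝ),
      (∀ (α : Matrix (Fin k) (Fin 1) ℂ), 0 ≤ r (α * αᴴ)) → ∀ x, 0 ≤ r (vecMulVec x (star x)) :=
    fun r hr x => by
      have := hr (of fun i _ => x i)
      have e : vecMulVec x (star x) = of (fun i (_ : Fin 1) => x i) * (of fun i (_ : Fin 1) => x i)ᴴ := by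
        ext i j; simp [vecMulVec_apply, mul_apply]
      rwa [e]
  -- Positivity of $p$ and of $q$ is the domination inequality with middle factor $0$ and one of the
  -- outer factors $0$.
  have hp := hpos p fun α => by
    have := h 1 α 0 0 (by rw [mnorm_zero]; exact zero_le_one)
    have e : biact α (0 : Matrix (Fin 1) (Fin 1) V) 0ᴴ = 0 := by ext; simp [biact]
    rw [e] at this
    simpa using this
  have hq := hpos q fun α => by
    have := h 1 0 α 0 (by rw [mnorm_zero]; exact zero_le_one)
    have e : biact 0 (0 : Matrix (Fin 1) (Fin 1) V) αᴴ = 0 := by ext; simp [biact]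
    rw [e] at this
    simpa using this
  -- The perturbation adds $\delta\,\mathrm{tr}(1)=\delta k$ to $p(1)$ and to $q(1)$; this must not
  -- exceed $\varepsilon$.
  set δ : ℝ := ε / (k + 1) with hδ
  have hδ0 : 0 < δ := by positivity
  have hδk : δ * k ≤ ε := by
    rw [hδ, div_mul_eq_mul_div, div_le_iff₀ (by positivity)]
    nlinarith
  obtain ⟨R, hR, eR⟩ := exists_isUnit_sum_norm_sq_mul p hp hδ0
  obtain ⟨S, hS, eS⟩ := exists_isUnit_sum_norm_sq_mul q hq hδ0
  rw [isUnit_iff_isUnit_det] at hR hS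
  -- A finite-dimensional GNS construction: $\theta$ is chosen so that
  -- $\langle\theta_m(v)x,y\rangle=F(R^{-1}Yv(S^{-1}X)^*)$, where $X,Y$ are the vectors $x,y$
  -- reshaped and conjugated. The majorants bound twice the real part by $\|Y\|_2^2+\|X\|_2^2$.
  let θ : V →ₗ[ℂ] Matrix (Fin k) (Fin k) ℂ :=
    { toFun := fun u => of fun s t => ∑ i, ∑ j, (R⁻¹ i s * star (S⁻¹ j t)) * F (single i j u)
      map_add' := fun u w => by
        ext s t; simp [single_add, mul_add, Finset.sum_add_distrib]
      map_smul' := fun c u => by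
        ext s t
        simp only [← smul_single, map_smul, smul_eq_mul, of_apply, Matrix.smul_apply,
          RingHom.id_apply, Finset.mul_sum]
        exact Finset.sum_congr rfl fun i _ => Finset.sum_congr rfl fun j _ => by ring }
  have form : ∀ (m : ℕ) (v : Matrix (Fin m) (Fin m) V) (x y : Fin m × Fin k → ℂ),
      ∑ a, ∑ b, star (y a) * comp _ _ _ _ _ (v.map θ) a b * x b =
        F (biact (R⁻¹ * of fun s c => star (y (c, s))) v
          (S⁻¹ * of fun t d => star (x (d, t)))ᴴ) := by
    intro m v x y
    have eF : ∀ u : Matrix (Fin k) (Fin k) V, F u = ∑ i, ∑ j, F (single i j (u i j)) := fun u => by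
      conv_lhs => rw [matrix_eq_sum_single u]
      simp only [map_sum]
    have eS : ∀ (i j : Fin k) {ι : Type} (s : Finset ι) (f : ι → V),
        F (single i j (∑ c ∈ s, f c)) = ∑ c ∈ s, F (single i j (f c)) := fun i j ι s f =>
      map_sum (F ∘ₗ singleLinearMap ℂ i j) f s
    have eC : ∀ (i j : Fin k) (c : ℂ) (u : V), F (single i j (c • u)) = c * F (single i j u) :=
      fun i j c u => map_smul (F ∘ₗ singleLinearMap ℂ i j) c u
    rw [eF]
    simp only [biact, eS, eC, comp_apply, Matrix.map_apply, mul_apply, conjTranspose_apply, of_apply,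
      Fintype.sum_prod_type, Finset.sum_mul, Finset.mul_sum, star_sum, star_mul', star_star, θ,
      LinearMap.coe_mk, AddHom.coe_mk]
    refine Eq.trans ?_ (sum_sum_comm_sum_sum _)
    refine Finset.sum_congr rfl fun c _ => ?_
    rw [Finset.sum_comm]
    refine Finset.sum_congr rfl fun d _ => ?_
    refine Eq.trans ?_ (sum_sum_comm_sum_sum _)
    rw [Finset.sum_comm]
    refine Finset.sum_congr rfl fun s _ => Finset.sum_congr rfl fun t _ =>
      Finset.sum_congr rfl fun i _ => Finset.sum_congr rfl fun j _ => ?_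
    ring
  have norms : ∀ (m : ℕ) (x : Fin m × Fin k → ℂ),
      ∑ b, ‖x b‖ ^ 2 = ∑ c, ∑ s, ‖(of fun s c => star (x (c, s)) : Matrix (Fin k) (Fin m) ℂ) s c‖ ^ 2 :=
    fun m x => by simp [Fintype.sum_prod_type]
  refine ⟨θ, fun m v hv => scalarNorm_le_of_form zero_le_one fun x y => ?_, ?_⟩
  · set X : Matrix (Fin k) (Fin m) ℂ := of fun t d => star (x (d, t))
    set Y : Matrix (Fin k) (Fin m) ℂ := of fun s c => star (y (c, s))
    have h1 := eR m (R⁻¹ * Y)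
    have h2 := eS m (S⁻¹ * X)
    rw [mul_nonsing_inv_cancel_left _ _ hR] at h1
    rw [mul_nonsing_inv_cancel_left _ _ hS] at h2
    rw [form, norms, norms, h1, h2]
    have h3 := h m (R⁻¹ * Y) (S⁻¹ * X) v hv
    have h4 : 0 ≤ δ * ∑ c, ∑ i, ‖(R⁻¹ * Y) i c‖ ^ 2 := by positivity
    have h5 : 0 ≤ δ * ∑ c, ∑ i, ‖(S⁻¹ * X) i c‖ ^ 2 := by positivity
    linarith
  -- Taking $Y=R$ and $X=S$ cancels the inverses and recovers $F(v_0)$. The squared lengths of these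
  -- vectors are $p(1)+\delta k$ and $q(1)+\delta k$, both at most $1+\varepsilon$.
  · have h1 := two_mul_re_form_le (comp _ _ _ _ _ (v₀.map θ)) (fun b => star (S b.2 b.1))
      (fun b => star (R b.2 b.1))
    have eR' : (of fun s c => star (star (R s c)) : Matrix (Fin k) (Fin k) ℂ) = R := by ext; simp
    have eS' : (of fun s c => star (star (S s c)) : Matrix (Fin k) (Fin k) ℂ) = S := by ext; simp
    have one_sq : ∑ c, ∑ i, ‖(1 : Matrix (Fin k) (Fin k) ℂ) i c‖ ^ 2 = k := by
      simp [one_apply, apply_ite norm]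
    rw [form, norms, norms, eR', eS', nonsing_inv_mul _ hR, nonsing_inv_mul _ hS, conjTranspose_one,
      biact_one_one, hF0, Complex.ofReal_re] at h1
    have h2 := eR k 1
    have h3 := eS k 1
    rw [one_sq, conjTranspose_one, mul_one, mul_one] at h2 h3
    rw [h2, h3] at h1
    have h4 := mul_le_mul_of_nonneg_left (show q 1 + δ * k + (p 1 + δ * k) ≤ 2 * (1 + ε) by linarith)
      (scalarNorm_nonneg (comp _ _ _ _ _ (v₀.map θ)))
    linarith

end OperatorSpace

/-! ### The action of $M_k(\mathcal T)$ on matrices over an operator space. -/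

namespace OperatorSpace

open Matrix

section tcAct

variable {E F : Type*} [AddCommGroup E] [Module ℂ E] [AddCommGroup F] [Module ℂ F] {k l N M : ℕ}

theorem tcAct_add_left (σ τ : Matrix (Fin k) (Fin k) (Matrix (Fin N) (Fin N) ℂ))
    (x : Matrix (Fin N) (Fin N) E) : tcAct (σ + τ) x = tcAct σ x + tcAct τ x := by
  ext i j; simp [tcAct, add_smul, Finset.sum_add_distrib]

theorem tcAct_smul_left (c : ℂ) (σ : Matrix (Fin k) (Fin k) (Matrix (Fin N) (Fin N) ℂ))
    (x : Matrix (Fin N) (Fin N) E) : tcAct (c • σ) x = c • tcAct σ x := by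
  ext i j; simp [tcAct, Finset.smul_sum, smul_smul]

theorem tcAct_sub_right (σ : Matrix (Fin k) (Fin k) (Matrix (Fin N) (Fin N) ℂ))
    (x y : Matrix (Fin N) (Fin N) E) : tcAct σ (x - y) = tcAct σ x - tcAct σ y := by
  ext i j; simp [tcAct, smul_sub, Finset.sum_sub_distrib]

theorem tcAct_smul_right (c : ℂ) (σ : Matrix (Fin k) (Fin k) (Matrix (Fin N) (Fin N) ℂ))
    (x : Matrix (Fin N) (Fin N) E) : tcAct σ (c • x) = c • tcAct σ x := by
  ext i j; simp only [tcAct, Finset.smul_sum, Matrix.smul_apply, smul_comm c]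

theorem map_tcAct (φ : E →ₗ[ℂ] F) (σ : Matrix (Fin k) (Fin k) (Matrix (Fin N) (Fin N) ℂ))
    (x : Matrix (Fin N) (Fin N) E) : (tcAct σ x).map φ = tcAct σ (x.map φ) := by
  ext i j; simp [tcAct]

theorem tcAct_biact (α : Matrix (Fin l) (Fin k) ℂ)
    (σ : Matrix (Fin k) (Fin k) (Matrix (Fin N) (Fin N) ℂ)) (β : Matrix (Fin k) (Fin l) ℂ)
    (x : Matrix (Fin N) (Fin N) E) : tcAct (biact α σ β) x = biact α (tcAct σ x) β := by
  ext i j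
  simp only [tcAct, biact, Matrix.sum_apply, Matrix.smul_apply, Finset.sum_smul, Finset.smul_sum,
    smul_smul, smul_eq_mul]
  exact sum_sum_comm_sum_sum _

theorem tcAct_dirSum (σ : Matrix (Fin k) (Fin k) (Matrix (Fin N) (Fin N) ℂ))
    (τ : Matrix (Fin l) (Fin l) (Matrix (Fin N) (Fin N) ℂ)) (x : Matrix (Fin N) (Fin N) E) :
    tcAct (dirSum σ τ) x = dirSum (tcAct σ x) (tcAct τ x) := by
  ext i j
  refine Fin.addCases (fun i => ?_) (fun i => ?_) i <;>
  refine Fin.addCases (fun j => ?_) (fun j => ?_) j <;>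
  simp [tcAct, dirSum_castAdd_castAdd, dirSum_natAdd_natAdd,
    dirSum_castAdd_natAdd, dirSum_natAdd_castAdd]

/-- The element of `M_N(𝒯)` which represents the identity map of `M_N`. -/
def tcId (N : ℕ) : Matrix (Fin N) (Fin N) (Matrix (Fin N) (Fin N) ℂ) := of fun i j => single i j 1

theorem tcAct_tcId (x : Matrix (Fin N) (Fin N) E) : tcAct (tcId N) x = x := by
  ext i j
  simp [tcAct, tcId, single_apply, ite_and, ite_smul]

/-- Extension by zero of functionals on `M_N` along `f`. -/
noncomputable def tcPad (f : Fin N → Fin M) (σ : Matrix (Fin k) (Fin k) (Matrix (Fin N) (Fin N) ℂ)) :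
    Matrix (Fin k) (Fin k) (Matrix (Fin M) (Fin M) ℂ) :=
  of fun i j => of fun p q =>
    Function.extend (Prod.map f f) (fun a => σ i j a.1 a.2) 0 (p, q)

theorem tcAct_tcPad {f : Fin N → Fin M} (hf : f.Injective)
    (σ : Matrix (Fin k) (Fin k) (Matrix (Fin N) (Fin N) ℂ)) (x : Matrix (Fin M) (Fin M) E) :
    tcAct (tcPad f σ) x = tcAct σ (x.submatrix f f) := by
  ext i j
  simp only [tcAct, tcPad, of_apply, submatrix_apply]
  rw [← Fintype.sum_prod_type'
      (f := fun p q => Function.extend (Prod.map f f) (fun a => σ i j a.1 a.2) 0 (p, q) • x p q),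
    ← Fintype.sum_prod_type' (f := fun p q => σ i j p q • x (f p) (f q))]
  have hff := hf.prodMap hf
  exact (Fintype.sum_of_injective _ hff _ _
    (fun i hi => by rw [Function.extend_apply' _ _ _ hi]; simp)
    fun i => by rw [hff.extend_apply]; rfl).symm

end tcAct

section tcNorm

variable {k l N M : ℕ}

theorem tcNorm_le_iff {σ : Matrix (Fin k) (Fin k) (Matrix (Fin N) (Fin N) ℂ)} {r : ℝ} (hr : 0 ≤ r) :
    tcNorm σ ≤ ENNReal.ofReal r ↔
      ∀ (m : ℕ) (a : Matrix (Fin m) (Fin m) (Matrix (Fin N) (Fin N) ℂ)),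
        scalarNorm (comp _ _ _ _ _ a) ≤ 1 →
        scalarNorm (comp _ _ _ _ _ (a.map (tcAct σ))) ≤ r := by
  simp only [tcNorm, iSup_le_iff, ENNReal.ofReal_le_ofReal_iff hr]

theorem tcNorm_tcId_le (N : ℕ) : tcNorm (tcId N) ≤ ENNReal.ofReal 1 := by
  refine (tcNorm_le_iff zero_le_one).2 fun m a ha => ?_
  have : a.map (tcAct (tcId N)) = a := Matrix.ext fun i j => tcAct_tcId (a i j)
  rwa [this]

theorem tcNorm_add_le {σ τ : Matrix (Fin k) (Fin k) (Matrix (Fin N) (Fin N) ℂ)} {r s : ℝ}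
    (hr : 0 ≤ r) (hs : 0 ≤ s) (hσ : tcNorm σ ≤ ENNReal.ofReal r) (hτ : tcNorm τ ≤ ENNReal.ofReal s) :
    tcNorm (σ + τ) ≤ ENNReal.ofReal (r + s) := by
  refine (tcNorm_le_iff (add_nonneg hr hs)).2 fun m a ha => ?_
  have : comp _ _ _ _ _ (a.map (tcAct (σ + τ))) =
      comp _ _ _ _ _ (a.map (tcAct σ)) + comp _ _ _ _ _ (a.map (tcAct τ)) := by
    ext ⟨i, s⟩ ⟨j, t⟩; simp [tcAct_add_left]
  rw [this]
  exact (scalarNorm_add_le _ _).trans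
    (add_le_add ((tcNorm_le_iff hr).1 hσ m a ha) ((tcNorm_le_iff hs).1 hτ m a ha))

theorem tcNorm_smul_le {σ : Matrix (Fin k) (Fin k) (Matrix (Fin N) (Fin N) ℂ)} {r : ℝ}
    (hr : 0 ≤ r) (hσ : tcNorm σ ≤ ENNReal.ofReal r) (c : ℂ) :
    tcNorm (c • σ) ≤ ENNReal.ofReal (‖c‖ * r) := by
  refine (tcNorm_le_iff (by positivity)).2 fun m a ha => ?_
  have : comp _ _ _ _ _ (a.map (tcAct (c • σ))) = c • comp _ _ _ _ _ (a.map (tcAct σ)) := by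
    ext ⟨i, s⟩ ⟨j, t⟩; simp [tcAct_smul_left]
  rw [this, scalarNorm_smul]
  exact mul_le_mul_of_nonneg_left ((tcNorm_le_iff hr).1 hσ m a ha) (norm_nonneg c)

theorem tcNorm_biact_le {σ : Matrix (Fin k) (Fin k) (Matrix (Fin N) (Fin N) ℂ)} {r : ℝ}
    (hr : 0 ≤ r) (hσ : tcNorm σ ≤ ENNReal.ofReal r) (α : Matrix (Fin l) (Fin k) ℂ)
    (β : Matrix (Fin k) (Fin l) ℂ) :
    tcNorm (biact α σ β) ≤ ENNReal.ofReal (scalarNorm α * r * scalarNorm β) := by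
  have hα := scalarNorm_nonneg α
  have hβ := scalarNorm_nonneg β
  refine (tcNorm_le_iff (by positivity)).2 fun m a ha => ?_
  have : comp _ _ _ _ _ (a.map (tcAct (biact α σ β))) =
      kroneckerMap (· * ·) (1 : Matrix (Fin m) (Fin m) ℂ) α * comp _ _ _ _ _ (a.map (tcAct σ)) *
        kroneckerMap (· * ·) (1 : Matrix (Fin m) (Fin m) ℂ) β := by
    ext ⟨i, s⟩ ⟨j, t⟩
    simp only [comp_apply, Matrix.map_apply, tcAct_biact, biact, smul_eq_mul, mul_apply,
      Fintype.sum_prod_type, kroneckerMap_apply, one_apply, ite_mul, one_mul, zero_mul, mul_ite,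
      mul_zero, Finset.sum_mul]
    simp only [Finset.sum_ite_irrel, Finset.sum_const_zero, Finset.sum_ite_eq, Finset.mem_univ,
      if_true, Finset.sum_ite_eq']
    rw [Finset.sum_comm]
    refine Finset.sum_congr rfl fun c _ => Finset.sum_congr rfl fun d _ => by ring
  rw [this]
  refine (scalarNorm_mul_le _ _).trans (mul_le_mul ((scalarNorm_mul_le _ _).trans
    (mul_le_mul (scalarNorm_one_kronecker_le α) ((tcNorm_le_iff hr).1 hσ m a ha)
      (scalarNorm_nonneg _) hα)) (scalarNorm_one_kronecker_le β) (scalarNorm_nonneg _) (by positivity))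

theorem tcNorm_dirSum_le {σ : Matrix (Fin k) (Fin k) (Matrix (Fin N) (Fin N) ℂ)}
    {τ : Matrix (Fin l) (Fin l) (Matrix (Fin N) (Fin N) ℂ)} {r : ℝ}
    (hr : 0 ≤ r) (hσ : tcNorm σ ≤ ENNReal.ofReal r) (hτ : tcNorm τ ≤ ENNReal.ofReal r) :
    tcNorm (dirSum σ τ) ≤ ENNReal.ofReal r := by
  refine (tcNorm_le_iff hr).2 fun m a ha => scalarNorm_le_of_form hr fun x y => ?_
  have h1 := (two_mul_re_form_le (comp _ _ _ _ _ (a.map (tcAct σ)))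
    (fun b => x (b.1, Fin.castAdd l b.2)) (fun b => y (b.1, Fin.castAdd l b.2))).trans
    (mul_le_mul_of_nonneg_right ((tcNorm_le_iff hr).1 hσ m a ha) (by positivity))
  have h2 := (two_mul_re_form_le (comp _ _ _ _ _ (a.map (tcAct τ)))
    (fun b => x (b.1, Fin.natAdd k b.2)) (fun b => y (b.1, Fin.natAdd k b.2))).trans
    (mul_le_mul_of_nonneg_right ((tcNorm_le_iff hr).1 hτ m a ha) (by positivity))
  simp only [Fintype.sum_prod_type, Fin.sum_univ_add, comp_apply, Matrix.map_apply, tcAct_dirSum,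
    dirSum_castAdd_castAdd, dirSum_natAdd_natAdd, dirSum_castAdd_natAdd, dirSum_natAdd_castAdd,
    Finset.sum_add_distrib, mul_zero, zero_mul, Finset.sum_const_zero, add_zero, zero_add,
    Complex.add_re] at h1 h2 ⊢
  linarith

theorem tcNorm_tcPad_le {f : Fin N → Fin M} (hf : f.Injective)
    {σ : Matrix (Fin k) (Fin k) (Matrix (Fin N) (Fin N) ℂ)} {r : ℝ}
    (hr : 0 ≤ r) (hσ : tcNorm σ ≤ ENNReal.ofReal r) : tcNorm (tcPad f σ) ≤ ENNReal.ofReal r := by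
  refine (tcNorm_le_iff hr).2 fun m a ha => ?_
  have e : a.map (tcAct (tcPad f σ)) = (a.map fun b => b.submatrix f f).map (tcAct σ) := 
    Matrix.ext fun i j => tcAct_tcPad hf σ (a i j)
  rw [e]
  refine (tcNorm_le_iff hr).1 hσ m _ (le_trans ?_ ha)
  have e2 : comp _ _ _ _ _ (a.map fun b => b.submatrix f f) =
      (comp _ _ _ _ _ a).submatrix (Prod.map id f) (Prod.map id f) := by ext; rfl
  rw [e2]
  exact scalarNorm_submatrix_le _ (Function.injective_id.prodMap hf)
    (Function.injective_id.prodMap hf)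

end tcNorm

variable {V : Type*} [NormedAddCommGroup V] [NormedSpace ℂ V] [OperatorSpace V]
variable {W : Type*} [NormedAddCommGroup W] [NormedSpace ℂ W] [OperatorSpace W]

/-- Completely bounded maps between matrix algebras act on the matrices over any operator space
with the same bound. -/
theorem mnorm_tcAct_le {k N : ℕ} {σ : Matrix (Fin k) (Fin k) (Matrix (Fin N) (Fin N) ℂ)} {r : ℝ}
    (hr : 0 ≤ r) (hσ : tcNorm σ ≤ ENNReal.ofReal r) (y : Matrix (Fin N) (Fin N) V) :
    mnorm k (tcAct σ y) ≤ r * mnorm N y := by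
  refine le_mul_of_le_on_unit_ball (f := fun y : Matrix (Fin N) (Fin N) V => mnorm k (tcAct σ y))
    (fun c x => by rw [tcAct_smul_right, mnorm_smul]) (mnorm_smul N) (mnorm_nonneg N)
    (fun y hy => ?_) y
  refine le_of_forall_pos_le_add fun ε hε => ?_
  -- Up to exchanging tensor factors, $\theta_k(\sigma(y))$ is $\sigma$ applied entrywise to the
  -- scalar matrix $a\in M_k(M_N)$ obtained from $\theta_N(y)$, and there the definition of `tcNorm`
  -- applies.
  obtain ⟨θ, hθ, h⟩ := exists_norming_contraction (tcAct σ y) (ε := ε / (r + 1)) (by positivity)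
  have swap : ∀ {κ : ℕ} (A : Matrix (Fin κ × Fin k) (Fin κ × Fin k) ℂ),
      scalarNorm (A.submatrix Prod.swap Prod.swap) ≤ scalarNorm A := fun A =>
    scalarNorm_submatrix_le A Prod.swap_injective Prod.swap_injective
  let a : Matrix (Fin k) (Fin k) (Matrix (Fin N) (Fin N) ℂ) :=
    of fun s t => of fun p q => θ (y p q) s t
  have e1 : comp _ _ _ _ _ a = (comp _ _ _ _ _ (y.map θ)).submatrix Prod.swap Prod.swap := by
    ext; rfl
  have e2 : comp _ _ _ _ _ ((tcAct σ y).map θ) =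
      (comp _ _ _ _ _ (a.map (tcAct σ))).submatrix Prod.swap Prod.swap := by
    ext ⟨i, s⟩ ⟨j, t⟩
    simp [tcAct, a, Matrix.sum_apply]
  have h1 : scalarNorm (comp _ _ _ _ _ a) ≤ 1 := by
    rw [e1]; exact (swap _).trans (hθ N y hy)
  have h2 : scalarNorm (comp _ _ _ _ _ ((tcAct σ y).map θ)) ≤ r := by
    rw [e2]
    exact (scalarNorm_submatrix_le _ Prod.swap_injective Prod.swap_injective).trans
      ((tcNorm_le_iff hr).1 hσ k a h1)
  refine h.trans ((mul_le_mul_of_nonneg_right h2 (by positivity)).trans ?_)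
  have : r * (ε / (r + 1)) ≤ ε := by
    rw [mul_div_assoc', div_le_iff₀ (by positivity)]; nlinarith
  linarith

/-! ### From the approximation property to cb approximation. -/

/-- The approximant is $\psi\varphi$ with $\psi$ nearly the identity on the single matrix $x$ whose
hull controls $\varphi$. -/
theorem exists_cb_approx_of_hasOAP (hV : HasOAP V) {φ : W →ₗ[ℂ] V} (hφ : IsCompletelyBounded φ)
    (hc : IsOperatorCompact φ) {ε : ℝ≥0∞} (hε : 0 < ε) :
    ∃ ψ : W →ₗ[ℂ] V, IsCompletelyBounded ψ ∧ IsFiniteRank ψ ∧ cbNorm (φ - ψ) < ε := by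
  obtain ⟨x, hx, hw⟩ := hc
  obtain ⟨δ, hδ0, hδε⟩ := exists_between hε
  obtain ⟨d, rfl⟩ : ∃ d : ℝ, δ = ENNReal.ofReal d := ⟨δ.toReal, (ENNReal.ofReal_toReal hδε.ne_top).symm⟩
  have hd : 0 < d := ENNReal.ofReal_pos.1 hδ0
  obtain ⟨ψ, hψ, hr, hψx⟩ := hV {x} (by simpa using hx) _ hδ0
  have hψx := hψx x (Finset.mem_singleton_self x)
  rw [infNorm] at hψx
  have hx' := (infNorm_le_iff hd.le).1 hψx.le
  obtain ⟨C, hC, hCb⟩ := hψ.exists_bound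
  obtain ⟨D, hD, hDb⟩ := hφ.exists_bound
  refine ⟨ψ ∘ₗ φ, isCompletelyBounded_of_bound (C * D) fun n w hw => ?_, ?_, lt_of_le_of_lt
    (cbNorm_le fun n w hw1 => ENNReal.ofReal_le_ofReal ?_) hδε⟩
  · have h1 := hCb n (w.map φ)
    have h2 := hDb n w
    have e : w.map (ψ ∘ₗ φ) = (w.map φ).map ψ := rfl
    rw [e]
    calc _ ≤ C * (D * 1) := h1.trans (by gcongr; exact h2.trans (by gcongr))
      _ = _ := by ring
  · have := hr
    unfold IsFiniteRank at *
    exact Submodule.finiteDimensional_of_le (LinearMap.range_comp_le_range φ ψ)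
  · refine le_of_forall_pos_le_add fun η hη => ?_
    obtain ⟨_, ⟨N, σ, hσ, rfl⟩, hu⟩ := hw n w hw1 (η / (1 + C)) (by positivity)
    rw [← ENNReal.ofReal_one] at hσ
    set v := w.map φ
    set u := tcAct σ (corner N x)
    -- The middle term is controlled by $\|(\mathrm{id}\otimes\psi)(x)-x\|$. The outer two cost
    -- $(1+C)\|v-u\|$, which explains the tolerance $\eta/(1+C)$.
    have e : w.map (φ - ψ ∘ₗ φ) = (v - u) + -(tcAct σ (corner N (x.map ψ - x))) + (u - v).map ψ := by
      have e1 : corner N (x.map ψ - x) = (corner N x).map ψ - corner N x := rfl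
      rw [e1, tcAct_sub_right, ← map_tcAct]
      ext i j
      simp [v, u]
    have h1 := (mnorm_tcAct_le zero_le_one hσ (corner N (x.map ψ - x))).trans
      ((one_mul _).le.trans (hx' N))
    have h2 := hCb n (u - v)
    rw [mnorm_sub_rev] at h2
    rw [e]
    have h3 : (1 + C) * mnorm n (v - u) ≤ η := by
      rw [lt_div_iff₀ (by positivity)] at hu; linarith
    have h4 := mnorm_add_le n ((v - u) + -(tcAct σ (corner N (x.map ψ - x)))) ((u - v).map ψ)
    have h5 := mnorm_add_le n (v - u) (-(tcAct σ (corner N (x.map ψ - x))))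
    rw [mnorm_neg] at h5
    linarith

end OperatorSpace

/-! ### Truncation, factorization and direct sums in $\mathcal K(V)$. -/

namespace OperatorSpace

open Matrix Filter Topology

/-- The truncation of an infinite matrix to its upper left corner. -/
def trunc {E : Type*} [Zero E] (n : ℕ) (x : Matrix ℕ ℕ E) : Matrix ℕ ℕ E :=
  fun i j => if i < n ∧ j < n then x i j else 0

theorem finite_support_trunc {E : Type*} [Zero E] (n : ℕ) (x : Matrix ℕ ℕ E) :
    {p : ℕ × ℕ | trunc n x p.1 p.2 ≠ 0}.Finite := by
  refine ((Set.finite_Iio n).prod (Set.finite_Iio n)).subset fun p hp => ?_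
  by_contra h
  exact hp (if_neg fun h' => h ⟨h'.1, h'.2⟩)

variable {V : Type*} [NormedAddCommGroup V] [NormedSpace ℂ V] [OperatorSpace V]

theorem mnorm_corner_smul_le {d e : ℕ → ℂ} {a b r : ℝ} (ha : 0 ≤ a) (hb : 0 ≤ b)
    (hd : ∀ i, ‖d i‖ ≤ a) (he : ∀ i, ‖e i‖ ≤ b) {N : ℕ} {x : Matrix ℕ ℕ V}
    (hx : mnorm N (corner N x) ≤ r) :
    mnorm N (corner N fun i j => (d i * e j) • x i j) ≤ a * r * b := by
  have : corner N (fun i j => (d i * e j) • x i j) =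
      biact (diagonal fun i : Fin N => d i) (corner N x) (diagonal fun j : Fin N => e j) := by
    ext i j
    simp [corner, biact, diagonal_apply]
    rfl
  rw [this]
  exact mnorm_biact_le_of_le (scalarNorm_diagonal_le ha fun i => hd i) hx
    (scalarNorm_diagonal_le hb fun i => he i)

theorem mnorm_corner_trunc_le (n N : ℕ) (x : Matrix ℕ ℕ V) :
    mnorm N (corner N (trunc n x)) ≤ mnorm N (corner N x) := by
  have : trunc n x = fun i j =>
      ((if i < n then (1 : ℂ) else 0) * (if j < n then (1 : ℂ) else 0)) • x i j := by
    funext i j; by_cases h1 : i < n <;> by_cases h2 : j < n <;> simp [trunc, h1, h2]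
  rw [this]
  refine (mnorm_corner_smul_le zero_le_one zero_le_one ?_ ?_ le_rfl).trans (by simp) <;>
  · intro i; split_ifs <;> simp

theorem mnorm_corner_mono {m n : ℕ} (h : m ≤ n) (x : Matrix ℕ ℕ V) :
    mnorm m (corner m x) ≤ mnorm n (corner n x) :=
  mnorm_submatrix_le (corner n x) (Fin.castLE_injective h) (Fin.castLE_injective h)

theorem mnorm_corner_trunc_le_corner (n N : ℕ) (x : Matrix ℕ ℕ V) :
    mnorm N (corner N (trunc n x)) ≤ mnorm n (corner n x) := by
  rcases le_total N n with h | h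
  · exact (mnorm_corner_trunc_le n N x).trans (mnorm_corner_mono h x)
  · have : corner N (trunc n x) = biact (selector (Fin.castLE h)).transpose (corner n x)
        (selector (Fin.castLE h)) := by
      ext i j
      simp only [corner, trunc, biact, submatrix_apply, transpose_apply, selector_apply, Fin.ext_iff,
        Fin.val_castLE, ite_mul, one_mul, zero_mul, ite_smul, one_smul, zero_smul]
      by_cases hi : (i : ℕ) < n
      · by_cases hj : (j : ℕ) < n
        · rw [if_pos ⟨hi, hj⟩, Finset.sum_eq_single ⟨i, hi⟩, Finset.sum_eq_single ⟨j, hj⟩]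
          · simp
          · intro b _ hb; simp [Fin.ext_iff] at hb; simp [hb]
          · simp
          · intro b _ hb; simp [Fin.ext_iff] at hb; simp [hb]
          · simp
        · rw [if_neg (by tauto)]
          refine (Finset.sum_eq_zero fun a _ => Finset.sum_eq_zero fun b _ => ?_).symm
          rw [if_neg (by omega : ¬ (b : ℕ) = j)]; simp
      · rw [if_neg (by tauto)]
        refine (Finset.sum_eq_zero fun a _ => Finset.sum_eq_zero fun b _ => ?_).symm
        rw [if_neg (by omega : ¬ (a : ℕ) = i)]
    rw [this]
    have hc := Fin.castLE_injective h
    simpa using mnorm_biact_le_of_le (scalarNorm_selector_transpose_le hc)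
      (le_refl (mnorm n (corner n x))) (scalarNorm_selector_le hc)

theorem mem_stabilization_of_trunc {x : Matrix ℕ ℕ V}
    (h : ∀ ε : ℝ, 0 < ε → ∃ n, ∀ N, mnorm N (corner N (x - trunc n x)) ≤ ε) :
    x ∈ stabilization V := by
  intro ε hε
  obtain ⟨δ, hδ0, hδε⟩ := exists_between hε
  have hδ : 0 < δ.toReal := ENNReal.toReal_pos hδ0.ne' hδε.ne_top
  obtain ⟨n, hn⟩ := h δ.toReal hδ
  refine ⟨trunc n x, finite_support_trunc n x, lt_of_le_of_lt ((infNorm_le_iff hδ.le).2 hn) ?_⟩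
  rwa [ENNReal.ofReal_toReal hδε.ne_top]

/-- Large truncations fix a finitely supported approximant $y$, so the error is $(x-y)$ minus its
own truncation, and truncation is contractive. -/
theorem exists_trunc_of_mem_stabilization {x : Matrix ℕ ℕ V} (hx : x ∈ stabilization V) {ε : ℝ}
    (hε : 0 < ε) : ∃ n₀, ∀ n, n₀ ≤ n → ∀ N, mnorm N (corner N (x - trunc n x)) ≤ ε := by
  obtain ⟨y, hy, hxy⟩ := hx (ENNReal.ofReal (ε / 2)) (by simpa using hε)
  have hxy := (infNorm_le_iff (by positivity)).1 hxy.le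
  obtain ⟨a, ha⟩ := (hy.image Prod.fst).bddAbove
  obtain ⟨b, hb⟩ := (hy.image Prod.snd).bddAbove
  refine ⟨max a b + 1, fun n hn N => ?_⟩
  have hyn : trunc n y = y := by
    funext i j
    rw [trunc, ite_eq_left_iff]
    intro h
    by_contra h0
    have h1 := ha ⟨(i, j), Ne.symm h0, rfl⟩
    have h2 := hb ⟨(i, j), Ne.symm h0, rfl⟩
    have := le_max_left a b
    have := le_max_right a b
    simp only at h1 h2
    omega
  have e : corner N (x - trunc n x) = corner N (x - y) - corner N (trunc n (x - y)) := by
    have : trunc n (x - y) = trunc n x - trunc n y := by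
      funext i j; simp only [trunc, Matrix.sub_apply]; split_ifs <;> simp
    rw [this, hyn]
    ext i j; simp [corner]
  rw [e]
  refine (mnorm_sub_le _ _ _).trans ?_
  linarith [hxy N, mnorm_corner_trunc_le n N (x - y)]

theorem exists_bound_of_mem_stabilization {x : Matrix ℕ ℕ V} (hx : x ∈ stabilization V) :
    ∃ C, ∀ N, mnorm N (corner N x) ≤ C := by
  obtain ⟨n, hn⟩ := exists_trunc_of_mem_stabilization hx one_pos
  refine ⟨1 + mnorm n (corner n x), fun N => ?_⟩
  have e : corner N x = corner N (x - trunc n x) + corner N (trunc n x) := by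
    ext i j; simp [corner]
  rw [e]
  exact (mnorm_add_le _ _ _).trans (add_le_add (hn n le_rfl N) (mnorm_corner_trunc_le_corner n N x))

/-- Here $c_i$ is the number of the block, among those ending at $n_0<n_1<\cdots$, that contains
$i$. It is the exponent of the weight given to the index $i$. -/
theorem exists_weights (n : ℕ → ℕ) (hn : StrictMono n) :
    ∃ c : ℕ → ℕ, ∀ i k, i < n k ↔ c i ≤ k := by
  classical
  have h : ∀ i, ∃ k, i < n k := fun i => ⟨i + 1, lt_of_lt_of_le (Nat.lt_succ_self i) (hn.le_apply)⟩
  refine ⟨fun i => Nat.find (h i), fun i k => ⟨fun hi => Nat.find_min' _ hi, fun hk => ?_⟩⟩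
  exact (Nat.find_spec (h i)).trans_le (hn.monotone hk)

/-- Every element of `𝒦(V)` is a product of an element of `𝒦(V)` with compact diagonal operators
on both sides. -/
theorem exists_diagonal_factorization {x : Matrix ℕ ℕ V} (hx : x ∈ stabilization V) :
    ∃ y ∈ stabilization V, ∃ s : ℕ → ℝ, (∀ i, 0 ≤ s i) ∧ (∀ i, s i ≤ 1) ∧ Tendsto s atTop (𝓝 0) ∧
      ∀ i j, x i j = ((s i : ℂ) * (s j : ℂ)) • y i j := by
  -- The rate $16^{-k}$ leaves a summable $4^{-k}$ after multiplication by weights of order $2^k$ on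
  -- each side.
  have hP : ∀ (k : ℕ), ∀ᶠ n in atTop, ∀ N, mnorm N (corner N (x - trunc n x)) ≤ (1 / 16 : ℝ) ^ k :=
    fun k => by
      obtain ⟨n₀, h⟩ := exists_trunc_of_mem_stabilization hx (ε := (1 / 16 : ℝ) ^ k) (by positivity)
      exact eventually_atTop.2 ⟨n₀, h⟩
  obtain ⟨n, hn, htail⟩ := extraction_forall_of_eventually hP
  obtain ⟨c, hc⟩ := exists_weights n hn
  set y : Matrix ℕ ℕ V := fun i j => ((2 : ℂ) ^ c i * (2 : ℂ) ^ c j) • x i j with hy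
  have step : ∀ k N, mnorm N (corner N (trunc (n (k + 1)) y - trunc (n k) y)) ≤ 8 * (1 / 4) ^ k := by
    intro k N
    have hd : ∀ i, ‖if c i ≤ k + 1 then (2 : ℂ) ^ c i else 0‖ ≤ 2 ^ (k + 1) := fun i => by
      split_ifs with h
      · simpa using pow_le_pow_right₀ one_le_two h
      · simp
    have hz : mnorm N (corner N (trunc (n (k + 1)) x - trunc (n k) x)) ≤ 2 * (1 / 16) ^ k := by
      have e : corner N (trunc (n (k + 1)) x - trunc (n k) x) =
          corner N (x - trunc (n k) x) - corner N (x - trunc (n (k + 1)) x) := by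
        ext i j; simp [corner]
      rw [e]
      refine (mnorm_sub_le _ _ _).trans ?_
      have h1 := htail k N
      have h2 := htail (k + 1) N
      have h3 : (1 / 16 : ℝ) ^ (k + 1) ≤ (1 / 16) ^ k :=
        pow_le_pow_of_le_one (by norm_num) (by norm_num) k.le_succ
      linarith
    have e : trunc (n (k + 1)) y - trunc (n k) y = fun i j =>
        ((if c i ≤ k + 1 then (2 : ℂ) ^ c i else 0) * (if c j ≤ k + 1 then (2 : ℂ) ^ c j else 0)) •
          (trunc (n (k + 1)) x - trunc (n k) x) i j := by
      funext i j
      have h3 : c i ≤ k → c i ≤ k + 1 := fun h => h.trans k.le_succ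
      have h4 : c j ≤ k → c j ≤ k + 1 := fun h => h.trans k.le_succ
      simp only [Matrix.sub_apply, trunc, hc, hy]
      by_cases h1 : c i ≤ k + 1 <;> by_cases h2 : c j ≤ k + 1 <;> by_cases h5 : c i ≤ k <;>
        by_cases h6 : c j ≤ k <;> simp [h1, h2, h5, h6] <;> tauto
    rw [e]
    -- $2^{k+1}\cdot 2\cdot16^{-k}\cdot2^{k+1}=8\cdot4^{-k}$.
    refine (mnorm_corner_smul_le (by positivity) (by positivity) hd hd hz).trans (le_of_eq ?_)
    have : ((2 : ℝ) ^ k * (1 / 16) ^ k * 2 ^ k) = (1 / 4) ^ k := by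
      rw [← mul_pow, ← mul_pow]; norm_num
    rw [← this]; ring
  -- The factor $16$ closes the induction: each step frees
  -- $16\cdot\tfrac34\cdot4^{-(K+M)}=12\cdot4^{-(K+M)}$, more than the $8\cdot4^{-(K+M)}$ needed.
  have tel : ∀ K M N, mnorm N (corner N (trunc (n (K + M)) y - trunc (n K) y)) ≤
      16 * ((1 / 4) ^ K - (1 / 4) ^ (K + M)) := by
    intro K M N
    induction M with
    | zero =>
      have : corner N (trunc (n (K + 0)) y - trunc (n K) y) = 0 := by ext i j; simp [corner]
      rw [this, mnorm_zero]; simp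
    | succ M ih =>
      have e : corner N (trunc (n (K + (M + 1))) y - trunc (n K) y) =
          corner N (trunc (n (K + M + 1)) y - trunc (n (K + M)) y) +
          corner N (trunc (n (K + M)) y - trunc (n K) y) := by
        ext i j; simp [corner, add_assoc]
      rw [e]
      refine (mnorm_add_le _ _ _).trans ((add_le_add (step (K + M) N) ih).trans ?_)
      have : (0 : ℝ) < (1 / 4) ^ (K + M) := by positivity
      rw [← add_assoc, pow_succ]
      linarith
  refine ⟨y, mem_stabilization_of_trunc fun ε hε => ?_, fun i => (1 / 2) ^ c i,
    fun i => by positivity, fun i => pow_le_one₀ (by norm_num) (by norm_num), ?_, fun i j => ?_⟩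
  · obtain ⟨K, hK⟩ := exists_pow_lt_of_lt_one (show 0 < ε / 16 by positivity)
      (show (1 / 4 : ℝ) < 1 by norm_num)
    refine ⟨n K, fun N => ?_⟩
    -- Since $n_{K+N}\ge N$, an $N\times N$ corner does not see the truncation at $n_{K+N}$.
    have e : corner N (y - trunc (n K) y) = corner N (trunc (n (K + N)) y - trunc (n K) y) := by
      ext i j
      have h : ∀ i : Fin N, (i : ℕ) < n (K + N) := fun i =>
        i.2.trans_le ((hn.le_apply).trans (hn.monotone (Nat.le_add_left N K)))
      have : trunc (n (K + N)) y i j = y i j := if_pos ⟨h i, h j⟩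
      simp [corner, this]
    rw [e]
    refine (tel K N N).trans ?_
    have : (0 : ℝ) < (1 / 4) ^ (K + N) := by positivity
    linarith
  · have hct : Tendsto c atTop atTop := by
      refine tendsto_atTop.2 fun K => eventually_atTop.2 ⟨n K, fun i hi => ?_⟩
      by_contra h
      exact absurd ((hc i K).2 (by omega)) (by omega)
    exact (tendsto_pow_atTop_nhds_zero_of_lt_one (by norm_num) (by norm_num)).comp hct
  · simp only [hy, smul_smul]
    push_cast
    have h : ∀ k : ℕ, (1 / 2 : ℂ) ^ k * 2 ^ k = 1 := fun k => by rw [← mul_pow]; norm_num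
    have : ((1 / 2 : ℂ) ^ c i * (1 / 2) ^ c j * (2 ^ c i * 2 ^ c j)) = 1 := by
      rw [mul_mul_mul_comm, h, h, one_mul]
    rw [this, one_smul]

/-- The direct sum of two infinite matrices, on the even and the odd indices. -/
def interleave {E : Type*} [Zero E] (x y : Matrix ℕ ℕ E) : Matrix ℕ ℕ E :=
  fun i j => if i % 2 = 0 ∧ j % 2 = 0 then x (i / 2) (j / 2)
    else if i % 2 = 1 ∧ j % 2 = 1 then y (i / 2) (j / 2) else 0

theorem mnorm_corner_interleave_le (N : ℕ) (x y : Matrix ℕ ℕ V) :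
    mnorm N (corner N (interleave x y)) ≤ max (mnorm N (corner N x)) (mnorm N (corner N y)) := by
  rw [← mnorm_dirSum]
  -- Even indices go to the left summand and odd ones to the right, so the corner is a submatrix of
  -- a direct sum.
  let f : Fin N → Fin (N + N) := fun i =>
    if (i : ℕ) % 2 = 0 then Fin.castAdd N ⟨i / 2, by omega⟩ else Fin.natAdd N ⟨i / 2, by omega⟩
  have hf : f.Injective := by
    intro i j h
    simp only [f] at h
    split_ifs at h <;> simp [Fin.ext_iff] at h ⊢ <;> omega
  have e : corner N (interleave x y) = (dirSum (corner N x) (corner N y)).submatrix f f := by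
    ext i j
    simp only [corner, interleave, submatrix_apply, f]
    rcases Nat.mod_two_eq_zero_or_one i with hi | hi <;>
    rcases Nat.mod_two_eq_zero_or_one j with hj | hj <;>
    simp only [hi, hj, and_self, and_true, and_false, reduceIte, one_ne_zero, zero_ne_one,
      dirSum_castAdd_castAdd, dirSum_natAdd_natAdd, dirSum_castAdd_natAdd, dirSum_natAdd_castAdd] <;>
    rfl
  rw [e]
  exact mnorm_submatrix_le _ hf hf

theorem interleave_mem_stabilization {x y : Matrix ℕ ℕ V} (hx : x ∈ stabilization V)
    (hy : y ∈ stabilization V) : interleave x y ∈ stabilization V := by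
  refine mem_stabilization_of_trunc fun ε hε => ?_
  obtain ⟨a, ha⟩ := exists_trunc_of_mem_stabilization hx hε
  obtain ⟨b, hb⟩ := exists_trunc_of_mem_stabilization hy hε
  refine ⟨2 * max a b, fun N => ?_⟩
  have e : interleave x y - trunc (2 * max a b) (interleave x y) =
      interleave (x - trunc (max a b) x) (y - trunc (max a b) y) := by
    funext i j
    have hi : i < 2 * max a b ↔ i / 2 < max a b := by omega
    have hj : j < 2 * max a b ↔ j / 2 < max a b := by omega
    simp only [interleave, trunc, Matrix.sub_apply, hi, hj]
    split_ifs <;> simp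
  rw [e]
  exact (mnorm_corner_interleave_le _ _ _).trans
    (max_le (ha _ (le_max_left _ _) N) (hb _ (le_max_right _ _) N))

theorem zero_mem_stabilization : (0 : Matrix ℕ ℕ V) ∈ stabilization V :=
  mem_stabilization_of_trunc fun ε hε => ⟨0, fun N => by
    have : corner N ((0 : Matrix ℕ ℕ V) - trunc 0 0) = 0 := by ext; simp [corner, trunc]
    rw [this, mnorm_zero]; exact hε.le⟩

/-- Finitely many elements of `𝒦(V)` are compressions of a single one. -/
theorem exists_common_dilation (F : Finset (Matrix ℕ ℕ V)) (hF : ∀ x ∈ F, x ∈ stabilization V) :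
    ∃ z ∈ stabilization V, ∀ x ∈ F, ∃ f : ℕ → ℕ, f.Injective ∧ x = z.submatrix f f := by
  classical
  induction F using Finset.induction_on with
  | empty => exact ⟨0, zero_mem_stabilization, by simp⟩
  | insert x F _ ih =>
    obtain ⟨z, hz, h⟩ := ih fun x hx => hF x (Finset.mem_insert_of_mem hx)
    refine ⟨interleave x z, interleave_mem_stabilization (hF x (Finset.mem_insert_self x F)) hz,
      fun w hw => ?_⟩
    rcases Finset.mem_insert.1 hw with rfl | hw
    · refine ⟨fun i => 2 * i, fun i j hij => by simpa using hij, ?_⟩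
      ext i j; simp [interleave]
    · obtain ⟨f, hf, e⟩ := h w hw
      refine ⟨fun i => 2 * f i + 1, fun i j hij => hf (by simpa using hij), ?_⟩
      ext i j
      have h2 : ∀ a, (2 * a + 1) / 2 = a := fun a => by omega
      have h3 : ∀ a, (2 * a + 1) % 2 = 1 := fun a => by omega
      simp [interleave, e, h2, h3]

theorem infNorm_submatrix_le (x : Matrix ℕ ℕ V) {f : ℕ → ℕ} (hf : f.Injective) :
    infNorm (x.submatrix f f) ≤ infNorm x := by
  refine iSup_le fun N => ?_
  obtain ⟨M, hM⟩ : ∃ M, ∀ i : Fin N, f i < M :=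
    ⟨(Finset.univ.sup fun i : Fin N => f i) + 1, fun i =>
      Nat.lt_succ_of_le (Finset.le_sup (f := fun i : Fin N => f i) (Finset.mem_univ i))⟩
  refine le_iSup_of_le M (ENNReal.ofReal_le_ofReal ?_)
  let g : Fin N → Fin M := fun i => ⟨f i, hM i⟩
  have hg : g.Injective := fun i j h => Fin.ext (hf (Fin.ext_iff.1 h))
  exact mnorm_submatrix_le (corner M x) hg hg

end OperatorSpace

/-! ### Multiples of the closed absolutely matrix convex hull. -/

namespace OperatorSpace

open Matrix Filter Topology

variable {V : Type*} [NormedAddCommGroup V] [NormedSpace ℂ V] [OperatorSpace V]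

/-- `v` lies in `r` times the closed absolutely matrix convex hull of `y`. -/
def InHull (y : Matrix ℕ ℕ V) (r : ℝ) {n : ℕ} (v : Matrix (Fin n) (Fin n) V) : Prop :=
  ∀ ε : ℝ, 0 < ε → ∃ (N : ℕ) (σ : Matrix (Fin n) (Fin n) (Matrix (Fin N) (Fin N) ℂ)),
    tcNorm σ ≤ ENNReal.ofReal r ∧ mnorm n (v - tcAct σ (corner N y)) < ε

section InHull

variable {y : Matrix ℕ ℕ V} {n m : ℕ} {r s C : ℝ} {v w : Matrix (Fin n) (Fin n) V}

theorem InHull.mono (h : InHull y r v) (hrs : r ≤ s) : InHull y s v := fun ε hε => by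
  obtain ⟨N, σ, hσ, hv⟩ := h ε hε
  exact ⟨N, σ, hσ.trans (ENNReal.ofReal_le_ofReal hrs), hv⟩

theorem inHull_tcAct {N : ℕ} {σ : Matrix (Fin n) (Fin n) (Matrix (Fin N) (Fin N) ℂ)}
    (hσ : tcNorm σ ≤ ENNReal.ofReal r) : InHull y r (tcAct σ (corner N y)) := fun ε hε =>
  ⟨N, σ, hσ, by rwa [sub_self, mnorm_zero]⟩

/-- Padding by zeros lets the approximants of two elements be taken over a common corner, so that
they can be added or placed in a direct sum. -/
theorem InHull.exists_enlarge (hr : 0 ≤ r) (h : InHull y r v) {ε : ℝ} (hε : 0 < ε) :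
    ∃ N, ∀ M, N ≤ M → ∃ σ : Matrix (Fin n) (Fin n) (Matrix (Fin M) (Fin M) ℂ),
      tcNorm σ ≤ ENNReal.ofReal r ∧ mnorm n (v - tcAct σ (corner M y)) < ε := by
  obtain ⟨N, σ, hσ, hv⟩ := h ε hε
  refine ⟨N, fun M hM => ⟨tcPad (Fin.castLE hM) σ, tcNorm_tcPad_le (Fin.castLE_injective hM) hr hσ, ?_⟩⟩
  rw [tcAct_tcPad (Fin.castLE_injective hM)]
  exact hv

theorem InHull.add (hr : 0 ≤ r) (hs : 0 ≤ s) (hv : InHull y r v) (hw : InHull y s w) :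
    InHull y (r + s) (v + w) := fun ε hε => by
  obtain ⟨N₁, h₁⟩ := hv.exists_enlarge hr (half_pos hε)
  obtain ⟨N₂, h₂⟩ := hw.exists_enlarge hs (half_pos hε)
  obtain ⟨σ, hσ, hvσ⟩ := h₁ _ (le_max_left N₁ N₂)
  obtain ⟨τ, hτ, hwτ⟩ := h₂ _ (le_max_right N₁ N₂)
  refine ⟨_, σ + τ, tcNorm_add_le hr hs hσ hτ, ?_⟩
  rw [tcAct_add_left, add_sub_add_comm]
  exact (mnorm_add_le _ _ _).trans_lt (by linarith)

theorem InHull.smul (hr : 0 ≤ r) (hv : InHull y r v) (c : ℂ) : InHull y (‖c‖ * r) (c • v) :=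
    fun ε hε => by
  obtain ⟨N, σ, hσ, h⟩ := hv (ε / (‖c‖ + 1)) (by positivity)
  refine ⟨N, c • σ, tcNorm_smul_le hr hσ c, ?_⟩
  rw [tcAct_smul_left, ← smul_sub, mnorm_smul]
  have h0 := mnorm_nonneg n (v - tcAct σ (corner N y))
  rw [lt_div_iff₀ (by positivity)] at h
  nlinarith

theorem InHull.biact (hr : 0 ≤ r) (hv : InHull y r v) (α : Matrix (Fin m) (Fin n) ℂ)
    (β : Matrix (Fin n) (Fin m) ℂ) :
    InHull y (scalarNorm α * r * scalarNorm β) (Matrix.biact α v β) := fun ε hε => by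
  have hα := scalarNorm_nonneg α
  have hβ := scalarNorm_nonneg β
  obtain ⟨N, σ, hσ, h⟩ := hv (ε / (scalarNorm α * scalarNorm β + 1)) (by positivity)
  refine ⟨N, Matrix.biact α σ β, tcNorm_biact_le hr hσ α β, ?_⟩
  have e : Matrix.biact α v β - tcAct (Matrix.biact α σ β) (corner N y) =
      Matrix.biact α (v - tcAct σ (corner N y)) β := by
    rw [tcAct_biact, sub_eq_add_neg v, biact_add, sub_eq_add_neg]
    congr 1
    simpa using (biact_smul α (-1) (tcAct σ (corner N y)) β).symm
  rw [e]
  refine (mnorm_biact_le _ _ _ _ _).trans_lt ?_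
  have h0 := mnorm_nonneg n (v - tcAct σ (corner N y))
  rw [lt_div_iff₀ (by positivity)] at h
  nlinarith

theorem InHull.exists_biact (hr : 0 ≤ r) (hv : InHull y r v) (α : Matrix (Fin m) (Fin n) ℂ)
    (β : Matrix (Fin n) (Fin m) ℂ) : ∃ s, 0 ≤ s ∧ InHull y s (Matrix.biact α v β) :=
  ⟨_, mul_nonneg (mul_nonneg (scalarNorm_nonneg α) hr) (scalarNorm_nonneg β), hv.biact hr α β⟩

theorem InHull.dirSum {w : Matrix (Fin m) (Fin m) V} (hr : 0 ≤ r) (hv : InHull y r v)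
    (hw : InHull y r w) : InHull y r (dirSum v w) := fun ε hε => by
  obtain ⟨N₁, h₁⟩ := hv.exists_enlarge hr hε
  obtain ⟨N₂, h₂⟩ := hw.exists_enlarge hr hε
  obtain ⟨σ, hσ, hvσ⟩ := h₁ _ (le_max_left N₁ N₂)
  obtain ⟨τ, hτ, hwτ⟩ := h₂ _ (le_max_right N₁ N₂)
  refine ⟨_, Matrix.dirSum σ τ, tcNorm_dirSum_le hr hσ hτ, ?_⟩
  have e : Matrix.dirSum v w - tcAct (Matrix.dirSum σ τ) (corner (max N₁ N₂) y) =
      Matrix.dirSum (v - tcAct σ (corner _ y)) (w - tcAct τ (corner _ y)) := by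
    rw [tcAct_dirSum, sub_eq_iff_eq_add, ← dirSum_add, sub_add_cancel, sub_add_cancel]
  rw [e, mnorm_dirSum]
  exact max_lt hvσ hwτ

theorem InHull.mnorm_le (hC : ∀ N, mnorm N (corner N y) ≤ C) (hr : 0 ≤ r) (hv : InHull y r v) :
    mnorm n v ≤ r * C := by
  refine le_of_forall_pos_le_add fun ε hε => ?_
  obtain ⟨N, σ, hσ, h⟩ := hv ε hε
  have h1 := (mnorm_tcAct_le hr hσ (corner N y)).trans (mul_le_mul_of_nonneg_left (hC N) hr)
  have h2 := mnorm_add_le n (v - tcAct σ (corner N y)) (tcAct σ (corner N y))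
  rw [sub_add_cancel] at h2
  linarith

theorem InHull.of_closure (h : ∀ ε : ℝ, 0 < ε → ∃ w, InHull y r w ∧ mnorm n (v - w) < ε) :
    InHull y r v := fun ε hε => by
  obtain ⟨w, hw, hvw⟩ := h (ε / 2) (half_pos hε)
  obtain ⟨N, σ, hσ, hwσ⟩ := hw (ε / 2) (half_pos hε)
  refine ⟨N, σ, hσ, ?_⟩
  rw [← sub_add_sub_cancel v w]
  exact (mnorm_add_le _ _ _).trans_lt (by linarith)

/-- Shrinking $v$ by $r/s$ puts it in the $r$-fold hull at the cost of an error at most $(s-r)C$.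
Consequently the infimum that defines the gauge is attained. -/
theorem InHull.of_forall_gt (hC : ∀ N, mnorm N (corner N y) ≤ C) (hr : 0 ≤ r)
    (h : ∀ s, r < s → InHull y s v) : InHull y r v := by
  have hC0 : 0 ≤ C := (mnorm_nonneg 0 _).trans (hC 0)
  refine InHull.of_closure fun ε hε => ?_
  set s := r + ε / (C + 1) with hs
  have hd : 0 < ε / (C + 1) := by positivity
  have hs0 : 0 < s := by positivity
  have hv := h s (by linarith)
  have hq : ‖((r / s : ℝ) : ℂ)‖ = r / s := by
    rw [Complex.norm_real, Real.norm_of_nonneg (by positivity)]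
  refine ⟨((r / s : ℝ) : ℂ) • v, ?_, ?_⟩
  · have := hv.smul hs0.le ((r / s : ℝ) : ℂ)
    rwa [hq, div_mul_cancel₀ _ hs0.ne'] at this
  · have e : v - ((r / s : ℝ) : ℂ) • v = ((1 - r / s : ℝ) : ℂ) • v := by
      push_cast; rw [sub_smul, one_smul]
    have e2 : 1 - r / s = (ε / (C + 1)) / s := by
      rw [eq_div_iff hs0.ne', sub_mul, div_mul_cancel₀ _ hs0.ne', hs]; ring
    rw [e, mnorm_smul, e2, Complex.norm_real, Real.norm_of_nonneg (by positivity)]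
    refine (mul_le_mul_of_nonneg_left (hv.mnorm_le hC hs0.le) (by positivity)).trans_lt ?_
    have : ε / (C + 1) / s * (s * C) = ε * (C / (C + 1)) := by field_simp
    rw [this]
    have : C / (C + 1) < 1 := by rw [div_lt_one (by positivity)]; linarith
    nlinarith

/-- The corner of $dye$ is the image of $y$ under $\sigma=d\cdot$`tcId`$\cdot e$, and `tcId` has
norm at most $1$. This turns decay of diagonal weights into smallness in the gauge. -/
theorem inHull_corner_smul {d e : ℕ → ℂ} {a b : ℝ} (ha : 0 ≤ a) (hb : 0 ≤ b)
    (hd : ∀ i, ‖d i‖ ≤ a) (he : ∀ i, ‖e i‖ ≤ b) (y : Matrix ℕ ℕ V) (N : ℕ) :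
    InHull y (a * b) (corner N fun i j => (d i * e j) • y i j) := by
  have h1 := tcNorm_biact_le zero_le_one (tcNorm_tcId_le N) (diagonal fun i : Fin N => d i)
    (diagonal fun j : Fin N => e j)
  have h2 := inHull_tcAct (y := y) h1
  rw [tcAct_biact, tcAct_tcId] at h2
  have h3 := scalarNorm_diagonal_le ha fun i : Fin N => hd i
  have h4 := scalarNorm_diagonal_le hb fun i : Fin N => he i
  have h5 := scalarNorm_nonneg (diagonal fun j : Fin N => e j)
  convert h2.mono (s := a * b) ?_ using 1
  · ext i j
    simp [corner, Matrix.biact, diagonal_apply]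
    rfl
  · rw [mul_one]; exact mul_le_mul h3 h4 h5 ha

theorem inHull_zero (hr : 0 ≤ r) : InHull y r (0 : Matrix (Fin n) (Fin n) V) := fun ε hε =>
  ⟨0, 0, by
    refine (tcNorm_le_iff hr).2 fun m a _ => ?_
    have : comp _ _ _ _ _ (a.map (tcAct (0 : Matrix (Fin n) (Fin n) (Matrix (Fin 0) (Fin 0) ℂ)))) = 0 := by
      ext ⟨i, s⟩ ⟨j, t⟩; simp [tcAct]
    rw [this, scalarNorm_zero]; exact hr, by
    have : tcAct (0 : Matrix (Fin n) (Fin n) (Matrix (Fin 0) (Fin 0) ℂ)) (corner 0 y) = 0 := by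
      ext; simp [tcAct]
    rwa [this, sub_zero, mnorm_zero]⟩

end InHull

/-! ### The operator space whose matrix unit ball is the closed hull. -/

/-- The vectors absorbed by the closed absolutely matrix convex hull of `y`. -/
def hullSubmodule (y : Matrix ℕ ℕ V) : Submodule ℂ V where
  carrier := {v | ∃ r, 0 ≤ r ∧ InHull y r (of fun _ _ : Fin 1 => v)}
  add_mem' := by
    rintro v w ⟨r, hr, hv⟩ ⟨s, hs, hw⟩
    exact ⟨r + s, add_nonneg hr hs, hv.add hr hs hw⟩
  zero_mem' := ⟨0, le_rfl, inHull_zero le_rfl⟩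
  smul_mem' := by
    rintro c v ⟨r, hr, hv⟩
    exact ⟨‖c‖ * r, by positivity, hv.smul hr c⟩

/-- The bounded infinite matrices. -/
abbrev BoundedMatrix (V : Type*) [NormedAddCommGroup V] [NormedSpace ℂ V] [OperatorSpace V] : Type _ :=
  {y : Matrix ℕ ℕ V // ∃ C, ∀ N, mnorm N (corner N y) ≤ C}

/-- The operator space spanned by the closed absolutely matrix convex hull of a bounded matrix,
with the hull as its matrix unit ball. -/
def HullSpace (y : BoundedMatrix V) : Type _ := hullSubmodule y.1

namespace HullSpace

variable (y : BoundedMatrix V)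

instance : AddCommGroup (HullSpace y) := inferInstanceAs (AddCommGroup (hullSubmodule y.1))

instance : Module ℂ (HullSpace y) := inferInstanceAs (Module ℂ (hullSubmodule y.1))

/-- The inclusion map. -/
def incl : HullSpace y →ₗ[ℂ] V := (hullSubmodule y.1).subtype

/-- The element of the hull space given by an absorbed vector. -/
def mk (v : V) (hv : v ∈ hullSubmodule y.1) : HullSpace y := ⟨v, hv⟩

theorem incl_mk (v : V) (hv : v ∈ hullSubmodule y.1) : incl y (mk y v hv) = v := rfl

theorem incl_injective : Function.Injective (incl y) := Subtype.val_injective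

variable {y}

/-- The matrix norms of the hull space: the gauges of the hull. -/
noncomputable def gauge (n : ℕ) (w : Matrix (Fin n) (Fin n) (HullSpace y)) : ℝ :=
  sInf {r | 0 ≤ r ∧ InHull y.1 r (w.map (incl y))}

/-- A matrix is a finite sum of single-entry matrices, and each of these is a two-sided scalar
product of an absorbed $1\times1$ matrix. Hence every gauge is finite. -/
theorem exists_inHull {n : ℕ} (w : Matrix (Fin n) (Fin n) (HullSpace y)) :
    ∃ r, 0 ≤ r ∧ InHull y.1 r (w.map (incl y)) := by
  have hsingle : ∀ i j, ∃ r, 0 ≤ r ∧ InHull y.1 r (single i j (incl y (w i j)) :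
      Matrix (Fin n) (Fin n) V) := fun i j => by
    obtain ⟨r, hr, h⟩ := (w i j).2
    obtain ⟨t, ht, h2⟩ := h.exists_biact hr (single i (0 : Fin 1) (1 : ℂ)) (single (0 : Fin 1) j (1 : ℂ))
    refine ⟨t, ht, ?_⟩
    convert h2 using 1
    ext a b
    simp only [Matrix.biact, single_apply, Finset.univ_unique, Finset.sum_singleton, of_apply]
    by_cases h1 : i = a <;> by_cases h2 : j = b <;> simp [h1, h2]
    rfl
  have sums : ∀ {ι : Type} (s : Finset ι) (f : ι → Matrix (Fin n) (Fin n) V),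
      (∀ i ∈ s, ∃ r, 0 ≤ r ∧ InHull y.1 r (f i)) → ∃ r, 0 ≤ r ∧ InHull y.1 r (∑ i ∈ s, f i) := by
    classical
    intro ι s f
    induction s using Finset.induction_on with
    | empty => exact fun _ => ⟨0, le_rfl, by simpa using inHull_zero le_rfl⟩
    | insert i s hi ih =>
      intro h
      obtain ⟨r, hr, h1⟩ := h i (Finset.mem_insert_self i s)
      obtain ⟨t, ht, h2⟩ := ih fun j hj => h j (Finset.mem_insert_of_mem hj)
      exact ⟨r + t, add_nonneg hr ht, by rw [Finset.sum_insert hi]; exact h1.add hr ht h2⟩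
  rw [matrix_eq_sum_single (w.map (incl y))]
  exact sums _ _ fun i _ => sums _ _ fun j _ => hsingle i j

theorem gauge_nonneg {n : ℕ} (w : Matrix (Fin n) (Fin n) (HullSpace y)) : 0 ≤ gauge n w :=
  Real.sInf_nonneg fun _ h => h.1

theorem inHull_gauge {n : ℕ} (w : Matrix (Fin n) (Fin n) (HullSpace y)) :
    InHull y.1 (gauge n w) (w.map (incl y)) := by
  obtain ⟨C, hC⟩ := y.2
  refine InHull.of_forall_gt hC (gauge_nonneg w) fun s hs => ?_
  obtain ⟨r, hr, hrs⟩ := exists_lt_of_csInf_lt (exists_inHull w) hs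
  exact hr.2.mono hrs.le

theorem gauge_le {n : ℕ} {w : Matrix (Fin n) (Fin n) (HullSpace y)} {r : ℝ} (hr : 0 ≤ r)
    (h : InHull y.1 r (w.map (incl y))) : gauge n w ≤ r :=
  csInf_le ⟨0, fun _ h => h.1⟩ ⟨hr, h⟩

theorem gauge_le_iff {n : ℕ} {w : Matrix (Fin n) (Fin n) (HullSpace y)} {r : ℝ} (hr : 0 ≤ r) :
    gauge n w ≤ r ↔ InHull y.1 r (w.map (incl y)) :=
  ⟨fun h => (inHull_gauge w).mono h, gauge_le hr⟩

theorem gauge_add_le {n : ℕ} (v w : Matrix (Fin n) (Fin n) (HullSpace y)) :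
    gauge n (v + w) ≤ gauge n v + gauge n w := by
  refine gauge_le (add_nonneg (gauge_nonneg v) (gauge_nonneg w)) ?_
  have := (inHull_gauge v).add (gauge_nonneg v) (gauge_nonneg w) (inHull_gauge w)
  rwa [← Matrix.map_add (incl y) (map_add _)] at this

theorem gauge_smul_le {n : ℕ} (c : ℂ) (w : Matrix (Fin n) (Fin n) (HullSpace y)) :
    gauge n (c • w) ≤ ‖c‖ * gauge n w := by
  refine gauge_le (mul_nonneg (norm_nonneg c) (gauge_nonneg w)) ?_
  rw [Matrix.map_smul (incl y) c (map_smul _ c)]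
  exact (inHull_gauge w).smul (gauge_nonneg w) c

theorem gauge_smul {n : ℕ} (c : ℂ) (w : Matrix (Fin n) (Fin n) (HullSpace y)) :
    gauge n (c • w) = ‖c‖ * gauge n w := by
  refine le_antisymm (gauge_smul_le c w) ?_
  rcases eq_or_ne c 0 with rfl | hc
  · simpa using gauge_nonneg _
  · have h := gauge_smul_le c⁻¹ (c • w)
    rwa [inv_smul_smul₀ hc, norm_inv, le_inv_mul_iff₀ (norm_pos_iff.2 hc)] at h

theorem eq_zero_of_gauge_eq_zero {n : ℕ} {w : Matrix (Fin n) (Fin n) (HullSpace y)}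
    (h : gauge n w = 0) : w = 0 := by
  obtain ⟨C, hC⟩ := y.2
  have h1 := (inHull_gauge w).mnorm_le hC (gauge_nonneg w)
  rw [h, zero_mul] at h1
  have h2 := mnorm_eq_zero.1 (le_antisymm h1 (mnorm_nonneg _ _))
  ext i j
  exact incl_injective y ((congrFun (congrFun h2 i) j).trans (map_zero _).symm)

theorem gauge_biact_le {m n : ℕ} (α : Matrix (Fin n) (Fin m) ℂ)
    (w : Matrix (Fin m) (Fin m) (HullSpace y)) (β : Matrix (Fin m) (Fin n) ℂ) :
    gauge n (biact α w β) ≤ scalarNorm α * gauge m w * scalarNorm β := by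
  refine gauge_le (mul_nonneg (mul_nonneg (scalarNorm_nonneg _) (gauge_nonneg w))
    (scalarNorm_nonneg _)) ?_
  rw [map_biact]
  exact (inHull_gauge w).biact (gauge_nonneg w) α β

theorem gauge_submatrix_le {m n : ℕ} (w : Matrix (Fin m) (Fin m) (HullSpace y)) {f : Fin n → Fin m}
    (hf : f.Injective) : gauge n (w.submatrix f f) ≤ gauge m w := by
  rw [← biact_selector]
  refine (gauge_biact_le _ _ _).trans ?_
  have h0 := gauge_nonneg w
  have h1 := scalarNorm_selector_le hf
  have h2 := scalarNorm_selector_transpose_le hf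
  have h3 := scalarNorm_nonneg (selector f)
  have h4 := scalarNorm_nonneg (selector f).transpose
  calc _ ≤ 1 * gauge m w * 1 := by gcongr
    _ = _ := by ring

theorem gauge_dirSum {m n : ℕ} (v : Matrix (Fin m) (Fin m) (HullSpace y))
    (w : Matrix (Fin n) (Fin n) (HullSpace y)) :
    gauge (m + n) (dirSum v w) = max (gauge m v) (gauge n w) := by
  refine le_antisymm ?_ (max_le ?_ ?_)
  · have h0 : 0 ≤ max (gauge m v) (gauge n w) := le_max_of_le_left (gauge_nonneg v)
    refine gauge_le h0 ?_
    rw [dirSum_map _ _ _ (map_zero _)]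
    exact ((inHull_gauge v).mono (le_max_left _ _)).dirSum h0
      ((inHull_gauge w).mono (le_max_right _ _))
  · simpa [dirSum_submatrix_left] using
      gauge_submatrix_le (dirSum v w) (Fin.castAdd_injective m n)
  · simpa [dirSum_submatrix_right] using
      gauge_submatrix_le (dirSum v w) (Fin.natAdd_injective n m)

noncomputable instance : Norm (HullSpace y) := ⟨fun v => gauge 1 (of fun _ _ => v)⟩

noncomputable instance : NormedAddCommGroup (HullSpace y) :=
  NormedAddCommGroup.ofCore (𝕜 := ℂ)
    { norm_nonneg := fun _ => gauge_nonneg _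
      norm_smul := fun c v => gauge_smul c (of fun _ _ => v)
      norm_triangle := fun v w => gauge_add_le (of fun _ _ => v) (of fun _ _ => w)
      norm_eq_zero_iff := fun v => ⟨fun h =>
        congrFun (congrFun (eq_zero_of_gauge_eq_zero h) 0) 0, fun h => by
          have := gauge_smul 0 (of fun _ _ : Fin 1 => v)
          rw [zero_smul, norm_zero, zero_mul] at this
          subst h
          exact this⟩ }

noncomputable instance : NormedSpace ℂ (HullSpace y) :=
  ⟨fun c v => gauge_smul_le c (of fun _ _ => v)⟩

noncomputable instance : OperatorSpace (HullSpace y) where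
  mnorm := gauge
  mnorm_add_le _ := gauge_add_le
  mnorm_smul _ := gauge_smul
  eq_zero_of_mnorm_eq_zero _ _ := eq_zero_of_gauge_eq_zero
  mnorm_one _ := rfl
  mnorm_dirSum _ _ := gauge_dirSum
  mnorm_biact_le _ _ := gauge_biact_le

theorem mnorm_le_iff {n : ℕ} {w : Matrix (Fin n) (Fin n) (HullSpace y)} {r : ℝ} (hr : 0 ≤ r) :
    mnorm n w ≤ r ↔ InHull y.1 r (w.map (incl y)) := gauge_le_iff hr

theorem isCompletelyBounded_incl : IsCompletelyBounded (incl y) := by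
  obtain ⟨C, hC⟩ := y.2
  refine isCompletelyBounded_of_bound C fun n w hw => ?_
  simpa using ((mnorm_le_iff zero_le_one).1 hw).mnorm_le hC zero_le_one

theorem isOperatorCompact_incl (hy : y.1 ∈ stabilization V) : IsOperatorCompact (incl y) := by
  refine ⟨y.1, hy, fun n w hw ε hε => ?_⟩
  obtain ⟨N, σ, hσ, h⟩ := (mnorm_le_iff zero_le_one).1 hw ε hε
  exact ⟨_, ⟨N, σ, by simpa using hσ, rfl⟩, h⟩

theorem norm_le_iff {v : HullSpace y} {r : ℝ} (hr : 0 ≤ r) :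
    ‖v‖ ≤ r ↔ InHull y.1 r (of fun _ _ : Fin 1 => incl y v) := gauge_le_iff hr

/-- A gauge-Cauchy sequence converges in $V$. Multiples of the hull are closed in $V$, so the gauge
estimates pass to the limit, which is therefore absorbed and is a limit in the gauge. -/
instance [CompleteSpace V] : CompleteSpace (HullSpace y) := by
  obtain ⟨C, hC⟩ := y.2
  have hC0 : 0 ≤ C := (mnorm_nonneg 0 _).trans (hC 0)
  have hincl : ∀ v : HullSpace y, ‖incl y v‖ ≤ ‖v‖ * C := fun v => by
    rw [← mnorm_one]
    exact ((norm_le_iff (norm_nonneg v)).1 le_rfl).mnorm_le hC (norm_nonneg v)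
  refine Metric.complete_of_cauchySeq_tendsto fun u hu => ?_
  have hV : CauchySeq fun n => incl y (u n) := by
    refine Metric.cauchySeq_iff'.2 fun ε hε => ?_
    obtain ⟨N, hN⟩ := Metric.cauchySeq_iff'.1 hu (ε / (C + 1)) (by positivity)
    refine ⟨N, fun n hn => ?_⟩
    have h1 := hN n hn
    rw [dist_eq_norm, lt_div_iff₀ (by positivity)] at h1
    rw [dist_eq_norm, ← map_sub]
    have h2 := hincl (u n - u N)
    have h3 := norm_nonneg (u n - u N)
    nlinarith
  obtain ⟨v, hv⟩ := cauchySeq_tendsto_of_complete hV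
  have key : ∀ ε : ℝ, 0 < ε → ∃ N, ∀ n, N ≤ n →
      InHull y.1 ε (of fun _ _ : Fin 1 => incl y (u n) - v) := fun ε hε => by
    obtain ⟨N, hN⟩ := Metric.cauchySeq_iff.1 hu ε hε
    refine ⟨N, fun n hn => InHull.of_closure fun δ hδ => ?_⟩
    obtain ⟨M, hM⟩ := Metric.tendsto_atTop.1 hv δ hδ
    refine ⟨_, (norm_le_iff hε.le).1 (dist_eq_norm (u n) (u (max N M)) ▸
      hN n hn (max N M) (le_max_left N M)).le, ?_⟩
    have e : ((of fun _ _ : Fin 1 => incl y (u n) - v) -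
        of fun _ _ : Fin 1 => incl y (u n - u (max N M))) =
        of fun _ _ : Fin 1 => incl y (u (max N M)) - v := by
      ext i j; simp
    rw [e, mnorm_one, ← dist_eq_norm]
    exact hM _ (le_max_right N M)
  obtain ⟨N, hN⟩ := key 1 one_pos
  have hmem : v ∈ hullSubmodule y.1 := by
    have h1 : incl y (u N) - v ∈ hullSubmodule y.1 := ⟨1, zero_le_one, hN N le_rfl⟩
    have h2 : incl y (u N) ∈ hullSubmodule y.1 := (u N).2
    simpa using (hullSubmodule y.1).sub_mem h2 h1
  refine ⟨mk y v hmem, Metric.tendsto_atTop.2 fun ε hε => ?_⟩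
  obtain ⟨N, hN⟩ := key (ε / 2) (half_pos hε)
  refine ⟨N, fun n hn => ?_⟩
  rw [dist_eq_norm]
  exact ((norm_le_iff (half_pos hε).le).2 (hN n hn)).trans_lt (half_lt_self hε)

end HullSpace

/-- Every element of `𝒦(V)` comes from an element of `𝒦(W)` under some operator compact
injection of a Banach space `W`. -/
theorem exists_hullSpace_lift {x : Matrix ℕ ℕ V} (hx : x ∈ stabilization V) :
    ∃ y : BoundedMatrix V, y.1 ∈ stabilization V ∧ ∃ w ∈ stabilization (HullSpace y),
      w.map (HullSpace.incl y) = x := by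
  obtain ⟨y, hy, s, hs0, hs1, hs, hxy⟩ := exists_diagonal_factorization hx
  have hsn : ∀ i, ‖(s i : ℂ)‖ ≤ 1 := fun i => by
    rw [Complex.norm_real, Real.norm_of_nonneg (hs0 i)]; exact hs1 i
  have hmem : ∀ i j, x i j ∈ hullSubmodule y := fun i j => by
    have h0 := inHull_corner_smul zero_le_one zero_le_one hsn hsn y (max i j + 1)
    obtain ⟨t, ht, h1⟩ := h0.exists_biact (mul_nonneg zero_le_one zero_le_one)
      (selector fun _ : Fin 1 => (⟨i, by omega⟩ : Fin (max i j + 1)))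
      (selector fun _ : Fin 1 => (⟨j, by omega⟩ : Fin (max i j + 1))).transpose
    rw [biact_selector] at h1
    refine ⟨t, ht, ?_⟩
    convert h1 using 1
    ext a b
    exact hxy i j
  set Y : BoundedMatrix V := ⟨y, exists_bound_of_mem_stabilization hy⟩
  refine ⟨Y, hy, fun i j => HullSpace.mk Y (x i j) (hmem i j), ?_, rfl⟩
  refine mem_stabilization_of_trunc fun ε hε => ?_
  obtain ⟨n, hn⟩ := eventually_atTop.1 (hs.eventually_le_const (half_pos hε))
  refine ⟨n, fun N => (HullSpace.mnorm_le_iff hε.le).2 ?_⟩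
  have hge : ∀ i, ‖if n ≤ i then (s i : ℂ) else 0‖ ≤ ε / 2 := fun i => by
    split_ifs with h
    · rw [Complex.norm_real, Real.norm_of_nonneg (hs0 i)]; exact hn i h
    · simpa using (half_pos hε).le
  have hlt : ∀ i, ‖if i < n then (s i : ℂ) else 0‖ ≤ 1 := fun i => by
    split_ifs with h
    · exact hsn i
    · simp
  -- Outside the $n\times n$ corner, $sys$ splits into the rows from $n$ on, and the earlier rows
  -- restricted to columns from $n$ on. Each piece has one factor bounded by $\varepsilon/2$ and the
  -- other by $1$.
  have h1 := inHull_corner_smul (half_pos hε).le zero_le_one hge hsn y N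
  have h2 := inHull_corner_smul zero_le_one (half_pos hε).le hlt hge y N
  have h3 := h1.add (by positivity) (by positivity) h2
  rw [mul_one, one_mul, add_halves] at h3
  convert h3 using 1
  ext i j
  have hL : HullSpace.incl Y (HullSpace.mk Y (x i j) (hmem i j) -
      if (i : ℕ) < n ∧ (j : ℕ) < n then HullSpace.mk Y (x i j) (hmem i j) else 0) =
      x i j - if (i : ℕ) < n ∧ (j : ℕ) < n then x i j else 0 := by
    rw [map_sub, apply_ite (HullSpace.incl Y), map_zero, HullSpace.incl_mk]
  refine hL.trans ?_
  rw [hxy]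
  show _ = ((if n ≤ (i : ℕ) then (s i : ℂ) else 0) * (s j : ℂ)) • y i j +
    ((if (i : ℕ) < n then (s i : ℂ) else 0) * (if n ≤ (j : ℕ) then (s j : ℂ) else 0)) • y i j
  simp only [← not_lt]
  by_cases hi : (i : ℕ) < n <;> by_cases hj : (j : ℕ) < n <;> simp [hi, hj]

end OperatorSpace

/-! ### Separation and slice maps. -/

namespace OperatorSpace

open Matrix Filter Topology

/-- Hahn-Banach in the quotient by $S$, where the class of $x$ has nonzero seminorm because $x$
stays at distance $\delta$ from $S$. -/
theorem _root_.Seminorm.exists_linearMap_vanishing {E : Type*} [AddCommGroup E] [Module ℂ E]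
    (p : Seminorm ℂ E) (S : Submodule ℂ E) (x : E) {δ : ℝ} (hδ : 0 < δ) (h : ∀ s ∈ S, δ ≤ p (x - s)) :
    ∃ g : E →ₗ[ℂ] ℂ, (∀ s ∈ S, g s = 0) ∧ g x ≠ 0 ∧ ∀ y, ‖g y‖ ≤ p y := by
  let _ : SeminormedAddCommGroup E := p.toAddGroupSeminorm.toSeminormedAddCommGroup
  let _ : NormedSpace ℂ E := ⟨fun c y => (map_smul_eq_mul p c y).le⟩
  have hnorm : ‖(Submodule.Quotient.mk x : E ⧸ S)‖ ≠ 0 := by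
    intro h0
    have h1 : x ∈ closure (S : Set E) :=
      (QuotientAddGroup.norm_mk_eq_zero_iff_mem_closure (S := S.toAddSubgroup)).1 h0
    obtain ⟨s, hs, hxs⟩ := Metric.mem_closure_iff.1 h1 δ hδ
    rw [dist_eq_norm] at hxs
    exact absurd (h s hs) (not_le.2 hxs)
  obtain ⟨g, hg, hgx⟩ := exists_dual_vector'' ℂ (Submodule.Quotient.mk x : E ⧸ S)
  refine ⟨g.toLinearMap ∘ₗ S.mkQ, fun s hs => ?_, ?_, fun y => ?_⟩
  · have : S.mkQ s = 0 := (Submodule.Quotient.mk_eq_zero S).2 hs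
    rw [LinearMap.comp_apply, this, map_zero]
  · intro h0
    exact hnorm (by simpa using hgx.symm.trans h0)
  · refine (g.le_of_opNorm_le hg _).trans ?_
    rw [one_mul]
    exact Submodule.Quotient.norm_mk_le S y

/-- The infinite scalar matrices which are bounded operators. -/
def boundedScalar : Submodule ℂ (Matrix ℕ ℕ ℂ) where
  carrier := {a | ∃ C, ∀ N, scalarNorm (corner N a) ≤ C}
  add_mem' := by
    rintro a b ⟨C, hC⟩ ⟨D, hD⟩
    exact ⟨C + D, fun N => (scalarNorm_add_le (corner N a) (corner N b)).trans
      (add_le_add (hC N) (hD N))⟩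
  zero_mem' := ⟨0, fun N => (scalarNorm_zero (m := Fin N) (n := Fin N)).le⟩
  smul_mem' := by
    rintro c a ⟨C, hC⟩
    exact ⟨‖c‖ * C, fun N => (scalarNorm_smul c (corner N a)).le.trans
      (mul_le_mul_of_nonneg_left (hC N) (norm_nonneg c))⟩

theorem bddAbove_scalarNorm_corner (a : boundedScalar) :
    BddAbove (Set.range fun N => scalarNorm (corner N a.1)) := by
  obtain ⟨C, hC⟩ := a.2
  exact ⟨C, by rintro _ ⟨N, rfl⟩; exact hC N⟩

/-- The operator norm of a bounded infinite matrix. -/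
noncomputable def boundedScalarNorm : Seminorm ℂ boundedScalar :=
  Seminorm.of (fun a => ⨆ N, scalarNorm (corner N a.1))
    (fun a b => ciSup_le fun N => (scalarNorm_add_le (corner N a.1) (corner N b.1)).trans
      (add_le_add (le_ciSup (bddAbove_scalarNorm_corner a) N)
        (le_ciSup (bddAbove_scalarNorm_corner b) N)))
    (fun c a => by
      rw [Real.mul_iSup_of_nonneg (norm_nonneg c)]
      exact iSup_congr fun N => scalarNorm_smul c (corner N a.1))

theorem boundedScalarNorm_le {a : boundedScalar} {C : ℝ}
    (h : ∀ N, scalarNorm (corner N a.1) ≤ C) : boundedScalarNorm a ≤ C := ciSup_le h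

theorem scalarNorm_corner_le (a : boundedScalar) (N : ℕ) :
    scalarNorm (corner N a.1) ≤ boundedScalarNorm a := le_ciSup (bddAbove_scalarNorm_corner a) N

/-- Hahn–Banach separation of a bounded matrix from a subspace of the bounded matrices. -/
theorem exists_separating_functional (S : Submodule ℂ (Matrix ℕ ℕ ℂ)) (hS : S ≤ boundedScalar)
    {a : Matrix ℕ ℕ ℂ} (ha : a ∈ boundedScalar) {δ : ℝ} (hδ : 0 < δ)
    (h : ∀ s ∈ S, ∃ N, δ < scalarNorm (corner N (a - s))) :
    ∃ τ : Matrix ℕ ℕ ℂ →ₗ[ℂ] ℂ, (∀ s ∈ S, τ s = 0) ∧ τ a ≠ 0 ∧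
      ∀ b D, (∀ N, scalarNorm (corner N b) ≤ D) → ‖τ b‖ ≤ D := by
  let a' : boundedScalar := ⟨a, ha⟩
  have hfar : ∀ s ∈ S.comap boundedScalar.subtype, δ ≤ boundedScalarNorm (a' - s) := by
    intro s hs
    obtain ⟨N, hN⟩ := h s.1 hs
    have h1 := scalarNorm_corner_le (a' - s) N
    have e : (a' - s).1 = a - s.1 := rfl
    rw [e] at h1
    exact hN.le.trans h1
  obtain ⟨g, hgS, hga, hg⟩ := boundedScalarNorm.exists_linearMap_vanishing _ a' hδ hfar
  -- The extension to all infinite matrices is purely algebraic. The norm bound is only claimed on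
  -- bounded matrices.
  obtain ⟨τ, hτ⟩ := LinearMap.exists_extend g
  have hτ' : ∀ b (hb : b ∈ boundedScalar), τ b = g ⟨b, hb⟩ := fun b hb =>
    LinearMap.congr_fun hτ ⟨b, hb⟩
  refine ⟨τ, fun s hs => ?_, ?_, fun b D hb => ?_⟩
  · rw [hτ' s (hS hs)]
    exact hgS _ hs
  · rw [hτ' a ha]
    exact hga
  · rw [hτ' b ⟨D, hb⟩]
    exact (hg _).trans (boundedScalarNorm_le hb)

variable {V : Type*} [NormedAddCommGroup V] [NormedSpace ℂ V] [OperatorSpace V]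
variable {W : Type*} [NormedAddCommGroup W] [NormedSpace ℂ W] [OperatorSpace W]

theorem IsCompletelyBounded.exists_norm_le {φ : W →ₗ[ℂ] V} (h : IsCompletelyBounded φ) :
    ∃ C, 0 ≤ C ∧ ∀ w, ‖φ w‖ ≤ C * ‖w‖ := by
  obtain ⟨C, hC, hb⟩ := h.exists_bound
  refine ⟨C, hC, fun w => ?_⟩
  have := hb 1 (of fun _ _ => w)
  rw [mnorm_one] at this
  exact (norm_entry_le_mnorm _ 0 0).trans this

theorem scalarNorm_corner_map_le (f : W →L[ℂ] ℂ) {z : Matrix ℕ ℕ W} {D : ℝ} {N : ℕ}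
    (h : mnorm N (corner N z) ≤ D) : scalarNorm (corner N (z.map f)) ≤ ‖f‖ * D :=
  (scalarNorm_map_le f.toLinearMap (norm_nonneg f) f.le_opNorm (corner N z)).trans
    (mul_le_mul_of_nonneg_left h (norm_nonneg f))

/-- Bounded functionals on the bounded scalar matrices slice elements of `𝒦(W)`. -/
theorem exists_slice [CompleteSpace W] {w : Matrix ℕ ℕ W} (hw : w ∈ stabilization W)
    (τ : Matrix ℕ ℕ ℂ →ₗ[ℂ] ℂ)
    (hτ : ∀ b D, (∀ N, scalarNorm (corner N b) ≤ D) → ‖τ b‖ ≤ D) :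
    ∃ u : W, ∀ f : W →L[ℂ] ℂ, τ (w.map f) = f u := by
  let E : ℕ → ℕ → Matrix ℕ ℕ ℂ := fun i j => of fun a b => if a = i ∧ b = j then 1 else 0
  let u : ℕ → W := fun n => ∑ i ∈ Finset.range n, ∑ j ∈ Finset.range n, τ (E i j) • w i j
  have hu : ∀ n (f : W →L[ℂ] ℂ), f (u n) = τ ((trunc n w).map f) := fun n f => by
    have e : (trunc n w).map f =
        ∑ i ∈ Finset.range n, ∑ j ∈ Finset.range n, f (w i j) • E i j := by
      ext a b
      simp only [Matrix.map_apply, trunc, Matrix.sum_apply, Matrix.smul_apply, E, of_apply,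
        smul_eq_mul, mul_ite, mul_one, mul_zero, ite_and]
      simp [Finset.sum_ite_eq, apply_ite f]
    rw [e]
    simp only [u, map_sum, map_smul, smul_eq_mul]
    exact Finset.sum_congr rfl fun i _ => Finset.sum_congr rfl fun j _ => mul_comm _ _
  have hbound : ∀ (f : W →L[ℂ] ℂ) (z : Matrix ℕ ℕ W) (D : ℝ), (∀ N, mnorm N (corner N z) ≤ D) →
      ‖τ (z.map f)‖ ≤ ‖f‖ * D := fun f z D hz =>
    hτ _ _ fun N => scalarNorm_corner_map_le f (hz N)
  have map_sub' : ∀ (f : W →L[ℂ] ℂ) (z z' : Matrix ℕ ℕ W),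
      τ ((z - z').map f) = τ (z.map f) - τ (z'.map f) := fun f z z' => by
    rw [← map_sub]; congr 1; ext; simp
  -- The slices of truncations are Cauchy in $W$: a norming functional $f$ for a difference of
  -- slices reduces it to $\tau$ on the scalar matrix $(\mathrm{id}\otimes f)$ of a difference of
  -- truncations.
  have hcauchy : CauchySeq u := by
    refine Metric.cauchySeq_iff'.2 fun ε hε => ?_
    obtain ⟨n₀, hn₀⟩ := exists_trunc_of_mem_stabilization hw (ε := ε / 4) (by positivity)
    refine ⟨n₀, fun n hn => ?_⟩
    obtain ⟨f, hf, hfu⟩ := exists_dual_vector'' ℂ (u n - u n₀)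
    have h1 : (‖u n - u n₀‖ : ℂ) = τ ((trunc n w - trunc n₀ w).map f) := by
      rw [map_sub', ← hu, ← hu, ← map_sub]; exact hfu.symm
    have h2 := hbound f (trunc n w - trunc n₀ w) (ε / 4 + ε / 4) fun N => by
      have e : corner N (trunc n w - trunc n₀ w) =
          corner N (w - trunc n₀ w) - corner N (w - trunc n w) := by ext; simp [corner]
      rw [e]
      exact (mnorm_sub_le _ _ _).trans (add_le_add (hn₀ n₀ le_rfl N) (hn₀ n hn N))
    rw [← h1, Complex.norm_real, norm_norm] at h2
    rw [dist_eq_norm]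
    refine h2.trans_lt ?_
    have h3 : ‖f‖ * (ε / 4 + ε / 4) ≤ 1 * (ε / 4 + ε / 4) := by gcongr
    linarith
  obtain ⟨u₀, hu₀⟩ := cauchySeq_tendsto_of_complete hcauchy
  refine ⟨u₀, fun f => ?_⟩
  have h1 : Tendsto (fun n => f (u n)) atTop (𝓝 (f u₀)) := (f.continuous.tendsto u₀).comp hu₀
  refine tendsto_nhds_unique ?_ h1
  refine Metric.tendsto_atTop.2 fun ε hε => ?_
  obtain ⟨n₀, hn₀⟩ := exists_trunc_of_mem_stabilization hw (ε := ε / (‖f‖ + 1)) (by positivity)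
  refine ⟨n₀, fun n hn => ?_⟩
  have h2 := hbound f (w - trunc n w) _ fun N => hn₀ n hn N
  rw [dist_comm, dist_eq_norm, hu, ← map_sub']
  refine h2.trans_lt ?_
  rw [mul_div_assoc', div_lt_iff₀ (by positivity)]
  nlinarith

/-- If `φ : W → V` is injective, then functionals on `W` are approximated, uniformly on a given
element of `𝒦(W)`, by functionals which factor through `φ`. -/
theorem exists_functional_approx [CompleteSpace W] {φ : W →ₗ[ℂ] V} (hφ : IsCompletelyBounded φ)
    (hinj : Function.Injective φ) {w : Matrix ℕ ℕ W} (hw : w ∈ stabilization W) (f : W →L[ℂ] ℂ)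
    {δ : ℝ} (hδ : 0 < δ) :
    ∃ g : V →L[ℂ] ℂ, ∀ N, scalarNorm (corner N (w.map f - (w.map φ).map g)) ≤ δ := by
  obtain ⟨K, hK0, hK⟩ := hφ.exists_norm_le
  obtain ⟨B, hB⟩ := exists_bound_of_mem_stabilization hw
  let Φ : W →L[ℂ] V := φ.mkContinuous K hK
  have hbdd : ∀ f : W →L[ℂ] ℂ, w.map f ∈ boundedScalar := fun f =>
    ⟨‖f‖ * B, fun N => scalarNorm_corner_map_le f (hB N)⟩
  let S : Submodule ℂ (Matrix ℕ ℕ ℂ) := LinearMap.range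
    ({ toFun := fun g => (w.map φ).map g
       map_add' := fun _ _ => by ext; simp
       map_smul' := fun _ _ => by ext; simp } : (V →L[ℂ] ℂ) →ₗ[ℂ] Matrix ℕ ℕ ℂ)
  by_contra! hcon
  obtain ⟨τ, hτS, hτf, hτ⟩ := exists_separating_functional S
    (by rintro _ ⟨g, rfl⟩; exact hbdd (g ∘L Φ)) (hbdd f) hδ
    (by rintro _ ⟨g, rfl⟩; exact hcon g)
  -- The functional $\tau$ kills every $(\mathrm{id}\otimes g\varphi)(w)$, so all $g\in V^*$ vanish
  -- at $\varphi(u)$. Injectivity forces $u=0$, while $\tau((\mathrm{id}\otimes f)(w))=f(u)$ is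
  -- nonzero.
  obtain ⟨u, hu⟩ := exists_slice hw τ hτ
  have hφu : φ u = 0 := by
    obtain ⟨g, -, hg⟩ := exists_dual_vector'' ℂ (φ u)
    have h1 : τ ((w.map φ).map g) = 0 := hτS _ ⟨g, rfl⟩
    have h2 : τ ((w.map φ).map g) = g (φ u) := hu (g ∘L Φ)
    rw [h1, hg] at h2
    exact norm_eq_zero.1 (by simpa using h2.symm)
  have hu0 : u = 0 := hinj (hφu.trans (map_zero φ).symm)
  exact hτf (by rw [hu, hu0, map_zero])

end OperatorSpace

/-! ### From cb approximation to the approximation property. -/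

namespace OperatorSpace

open Matrix Filter Topology

variable {V : Type*} [NormedAddCommGroup V] [NormedSpace ℂ V] [OperatorSpace V]
variable {W : Type*} [NormedAddCommGroup W] [NormedSpace ℂ W] [OperatorSpace W]

theorem isCompletelyBounded_sum_smulRight {d : ℕ} (g : Fin d → V →L[ℂ] ℂ) (b : Fin d → V) :
    IsCompletelyBounded (∑ i, (g i).toLinearMap.smulRight (b i)) := by
  refine isCompletelyBounded_of_bound (∑ i, ‖g i‖ * ‖b i‖) fun n v hv => ?_
  have e : v.map (∑ i, (g i).toLinearMap.smulRight (b i) : V →ₗ[ℂ] V) =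
      ∑ i, (v.map (g i)).map (· • b i) := by
    ext; simp [Matrix.sum_apply]
  rw [e]
  refine (mnorm_sum_le _ _).trans (Finset.sum_le_sum fun i _ => (mnorm_map_smul_le _ _).trans ?_)
  gcongr
  have h := scalarNorm_map_le (g i).toLinearMap (norm_nonneg _) (g i).le_opNorm v
  exact h.trans (mul_le_of_le_one_right (norm_nonneg _) hv)

omit [OperatorSpace V] in
theorem isFiniteRank_sum_smulRight {d : ℕ} (g : Fin d → V →L[ℂ] ℂ) (b : Fin d → V) :
    IsFiniteRank (∑ i, (g i).toLinearMap.smulRight (b i)) := by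
  have hle : LinearMap.range (∑ i, (g i).toLinearMap.smulRight (b i)) ≤
      Submodule.span ℂ (Set.range b) := by
    rintro _ ⟨v, rfl⟩
    simp only [LinearMap.sum_apply, LinearMap.smulRight_apply]
    exact Submodule.sum_mem _ fun i _ => Submodule.smul_mem _ _ (Submodule.subset_span ⟨i, rfl⟩)
  have := FiniteDimensional.span_of_finite ℂ (Set.finite_range b)
  exact Submodule.finiteDimensional_of_le hle

/-- A completely bounded finite rank map on `W` factors, approximately on a given element of
`𝒦(W)`, through an injection `φ : W → V`. -/
theorem exists_finiteRank_factorization [CompleteSpace W] {φ : W →ₗ[ℂ] V}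
    (hφ : IsCompletelyBounded φ) (hinj : Function.Injective φ) {w : Matrix ℕ ℕ W}
    (hw : w ∈ stabilization W) {ψ : W →ₗ[ℂ] V} (hψ : IsCompletelyBounded ψ) (hr : IsFiniteRank ψ)
    {δ : ℝ} (hδ : 0 < δ) :
    ∃ χ : V →ₗ[ℂ] V, IsCompletelyBounded χ ∧ IsFiniteRank χ ∧
      ∀ N, mnorm N (corner N (w.map ψ - (w.map φ).map χ)) ≤ δ := by
  obtain ⟨K, hK0, hK⟩ := hψ.exists_norm_le
  have : FiniteDimensional ℂ (LinearMap.range ψ) := hr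
  let b := Module.finBasis ℂ (LinearMap.range ψ)
  let Ψ : W →L[ℂ] LinearMap.range ψ :=
    (ψ.mkContinuous K hK).codRestrict (LinearMap.range ψ) fun w => ⟨w, rfl⟩
  let f := fun i => (LinearMap.toContinuousLinearMap (b.coord i)) ∘L Ψ
  have hf : ∀ w, ψ w = ∑ i, f i w • (b i : V) := fun w => by
    have h := congrArg (Submodule.subtype _) (b.sum_repr (Ψ w))
    rw [map_sum] at h
    exact h.symm
  set S := ∑ i, ‖(b i : V)‖ with hS
  have hS0 : 0 ≤ S := Finset.sum_nonneg fun i _ => norm_nonneg _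
  -- Replacing the coordinate $f_i$ by $g_i\varphi$ costs at most $\delta\|b_i\|/(S+1)$ on $w$,
  -- hence at most $\delta$ in all.
  choose g hg using fun i => exists_functional_approx hφ hinj hw (f i)
    (show 0 < δ / (S + 1) by positivity)
  refine ⟨∑ i, (g i).toLinearMap.smulRight (b i : V), isCompletelyBounded_sum_smulRight _ _,
    isFiniteRank_sum_smulRight _ _, fun N => ?_⟩
  have e : corner N (w.map ψ -
      (w.map φ).map (∑ i, (g i).toLinearMap.smulRight (b i : V) : V →ₗ[ℂ] V)) =
      ∑ i, (corner N (w.map (f i) - (w.map φ).map (g i))).map (· • (b i : V)) := by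
    ext p q
    simp [corner, Matrix.sum_apply, hf, sub_smul, Finset.sum_sub_distrib]
  rw [e]
  refine (mnorm_sum_le _ _).trans ((Finset.sum_le_sum fun i _ => (mnorm_map_smul_le _ _).trans
    (mul_le_mul_of_nonneg_right (hg i N) (norm_nonneg _))).trans ?_)
  rw [← Finset.mul_sum, ← hS, div_mul_eq_mul_div, div_le_iff₀ (by positivity)]
  nlinarith

/-- The only test space needed is the hull space of a single $y$, which lies in the universe of $V$.
-/
theorem hasOAP_of_cb_approx {V : Type u} [NormedAddCommGroup V] [NormedSpace ℂ V] [CompleteSpace V]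
    [OperatorSpace V]
    (h : ∀ (W : Type u) [NormedAddCommGroup W] [NormedSpace ℂ W] [CompleteSpace W] [OperatorSpace W]
      (φ : W →ₗ[ℂ] V), IsCompletelyBounded φ → IsOperatorCompact φ →
      ∀ ε : ℝ≥0∞, 0 < ε → ∃ ψ : W →ₗ[ℂ] V, IsCompletelyBounded ψ ∧ IsFiniteRank ψ ∧
        cbNorm (φ - ψ) < ε) : HasOAP V := by
  intro F hF ε hε
  obtain ⟨x, hx, hxF⟩ := exists_common_dilation F hF
  obtain ⟨y, hy, w, hw, rfl⟩ := exists_hullSpace_lift hx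
  obtain ⟨B, hB⟩ := exists_bound_of_mem_stabilization hw
  have hB0 : 0 ≤ B := (mnorm_nonneg 0 _).trans (hB 0)
  obtain ⟨δ', hδ0, hδε⟩ := exists_between hε
  obtain ⟨δ, rfl⟩ : ∃ δ : ℝ, δ' = ENNReal.ofReal δ :=
    ⟨δ'.toReal, (ENNReal.ofReal_toReal hδε.ne_top).symm⟩
  have hδ : 0 < δ := ENNReal.ofReal_pos.1 hδ0
  obtain ⟨ψ, hψ, hr, hφψ⟩ := h (HullSpace y) (HullSpace.incl y) HullSpace.isCompletelyBounded_incl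
    (HullSpace.isOperatorCompact_incl hy) (ENNReal.ofReal (δ / 2 / (B + 1)))
    (ENNReal.ofReal_pos.2 (by positivity))
  obtain ⟨χ, hχ, hχr, hχψ⟩ := exists_finiteRank_factorization HullSpace.isCompletelyBounded_incl
    (HullSpace.incl_injective y) hw hψ hr (half_pos hδ)
  refine ⟨χ, hχ, hχr, fun z hz => ?_⟩
  obtain ⟨f, hf, rfl⟩ := hxF z hz
  refine lt_of_le_of_lt (infNorm_submatrix_le ((w.map (HullSpace.incl y)).map χ -
    w.map (HullSpace.incl y)) hf) (lt_of_le_of_lt ((infNorm_le_iff hδ.le).2 fun N => ?_) hδε)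
  have h1 := mnorm_map_le_cbNorm (by positivity) hφψ.le (corner N w)
  have h2 : δ / 2 / (B + 1) * mnorm N (corner N w) ≤ δ / 2 := by
    refine (mul_le_mul_of_nonneg_left (hB N) (by positivity)).trans ?_
    rw [div_mul_eq_mul_div, div_le_iff₀ (by positivity)]
    nlinarith
  -- With $\iota$ the inclusion and $x=\iota(w)$, this is $\chi x-x=-(\psi w-\chi\iota
  -- w)-(\iota-\psi)w$; each part has norm at most $\delta/2$.
  have e : corner N ((w.map (HullSpace.incl y)).map χ - w.map (HullSpace.incl y)) =
      -(corner N (w.map ψ - (w.map (HullSpace.incl y)).map χ)) -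
        (corner N w).map (HullSpace.incl y - ψ) := by
    ext i j
    simp [corner]
  rw [e]
  refine (mnorm_sub_le _ _ _).trans ?_
  rw [mnorm_neg]
  linarith [hχψ N]

end OperatorSpace

theorem mainTheorem1 (V : Type u) [NormedAddCommGroup V] [NormedSpace ℂ V] [CompleteSpace V]
    [OperatorSpace V] :
    OperatorSpace.HasOAP V ↔
      ∀ (W : Type u) [NormedAddCommGroup W] [NormedSpace ℂ W] [CompleteSpace W] [OperatorSpace W]
        (φ : W →ₗ[ℂ] V), OperatorSpace.IsCompletelyBounded φ → OperatorSpace.IsOperatorCompact φ →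
        ∀ ε : ENNReal, 0 < ε → ∃ ψ : W →ₗ[ℂ] V, OperatorSpace.IsCompletelyBounded ψ ∧
          OperatorSpace.IsFiniteRank ψ ∧ OperatorSpace.cbNorm (φ - ψ) < ε :=
  ⟨fun hV _ _ _ _ _ _ hφ hc _ hε => OperatorSpace.exists_cb_approx_of_hasOAP hV hφ hc hε,
    OperatorSpace.hasOAP_of_cb_approx⟩
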